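/- Let $G=(V,E)$ be a finite connected simple graph with a fixed linear order $e_1<e_2<\dots<e_n$ on its edges and a chosen root vertex $v_d\in V$. A broken circuit is the edge set of a cycle of $G$ with its least edge removed, and $\mathrm{NBC}$ is the simplicial complex of the edge sets $S\subseteq E$ that contain no broken circuit; an NBC spanning tree is a spanning tree of $G$ whose edge set lies in $\mathrm{NBC}$. For an edge $e$ of a spanning tree $T$ let $\mathrm{cut}(T,e)$ be the set of edges $e'$ of $G$ such that $(T\setminus e)\cup e'$ is connected, and let $\mathrm{IN}(T)$ be the set of edges $e\in T$ that are not the least element of $\mathrm{cut}(T,e)$. The chromatic complex of $G$ over $\mathcal A_2=\mathbb Z[x]/(x^2)$ is the cochain complex freely generated over $\mathbb Z$ by the enhanced spanning subgraphs $(H,\epsilon)$, where $H$ is a spanning subgraph of $G$ and $\epsilon$ assigns to each connected component of $H$ a colour $1$ or $x$; the degree is $|E(H)|$ and $$d(H,\epsilon)=\sum_{e\notin E(H)}(-1)^{|\{f\in E(H):\,f<e\}|}\,(H\cup e,\epsilon_e),$$ where, if $e$ joins two different components of $H$, their union gets the product of their colours in $\mathcal A_2$ (the term being $0$ if this product is $0$),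 and all other colours are kept. Restricting to the generators with $E(H)\in\mathrm{NBC}$, and dropping all other terms of the differential, gives the complex $C(\mathrm{NBC})$. A matching on a based cochain complex is a set $\mathcal M$ of pairs $(c,c')$ of basis elements with non-zero incidence $[c:c']$ (the coefficient of $c'$ in $dc$), no two of which share an element; it is acyclic if all these incidences are invertible and the directed graph with arrows $c\to c'$ for $[c:c']\ne0$ has no directed cycle after the arrows in $\mathcal M$ are reversed. A basis element is critical if it lies in no pair of $\mathcal M$. Then: (1) The facets of $\mathrm{NBC}$ are exactly the NBC spanning trees of $G$. Their lexicographic order (edges listed increasingly) is a shelling of the pure complex $\mathrm{NBC}$. For every NBC spanning tree $T$, the restriction $\mathcal R(T)=\{e\in T: T\setminus e \text{ is contained in a lexicographically smaller facet}\}$ equals $\mathrm{IN}(T)$, and the intervals $[\mathrm{IN}(T),T]$ partition $\mathrm{NBC}$. (2) There is an acyclic matching $\mathcal M_{\mathrm{NBC}}$ on $C(\mathrm{NBC})$ such that for each of its pairs the two edge sets lie in a common interval $[\mathrm{IN}(T),T]$, with $T$ an NBC spanning tree. Its critical states are in bijection with the signed NBC spanning trees $T^{+},T^{-}$ of $G$: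 the tree $T^{\pm}$ corresponds to the state $H_c^{T^\pm}$ with edge set $\mathrm{IN}(T)$, where for $T^-$ all components are coloured $x$, and for $T^+$ the component of $v_d$ is coloured $1$ and all other components are coloured $x$. -/

import Mathlib

/-! ### Algebraic Morse theory: matchings on a based cochain complex -/

noncomputable section

/-- A cochain complex of free `R`-modules with a chosen homogeneous basis `Ω`: the module in
cohomological degree `i` is free on `{c : Ω | deg c = i}`, and `d` is the total differential. -/
structure BasedCochainComplex.{u, v} (R : Type u) [CommRing R] where
  /-- the basis -/
  Ω : Type v
  /-- the cohomological degree of a basis element -/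
  deg : Ω → ℕ
  /-- the differential -/
  d : (Ω →₀ R) →ₗ[R] (Ω →₀ R)
  deg_of_d_ne_zero : ∀ c c' : Ω, d (Finsupp.single c 1) c' ≠ 0 → deg c' = deg c + 1
  d_comp_d : d ∘ₗ d = 0

namespace BasedCochainComplex

variable {R : Type*} [CommRing R] (K : BasedCochainComplex R)

/-- The incidence `[c : c']`, the coefficient of `c'` in the differential of `c`. -/
def incidence (c c' : K.Ω) : R := K.d (Finsupp.single c 1) c'

/-- The arrows of the directed graph of `K`: `c → c'` whenever `[c : c'] ≠ 0`. -/
def Arrow (c c' : K.Ω) : Prop := K.incidence c c' ≠ 0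

/-- A set of arrows no two of which share a vertex. -/
def IsMatching (M : Set (K.Ω × K.Ω)) : Prop :=
  (∀ p ∈ M, K.Arrow p.1 p.2) ∧
    ∀ p ∈ M, ∀ q ∈ M, p ≠ q → p.1 ≠ q.1 ∧ p.1 ≠ q.2 ∧ p.2 ≠ q.1 ∧ p.2 ≠ q.2

/-- The arrows of the directed graph of `K` after the arrows in `M` have been reversed. -/
def ReversedArrow (M : Set (K.Ω × K.Ω)) (c c' : K.Ω) : Prop :=
  (K.Arrow c c' ∧ (c, c') ∉ M) ∨ (c', c) ∈ M

/-- An acyclic matching: a matching along invertible weights such that the graph with the arrows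
of the matching reversed has no directed cycle. -/
def IsAcyclicMatching (M : Set (K.Ω × K.Ω)) : Prop :=
  K.IsMatching M ∧ (∀ p ∈ M, IsUnit (K.incidence p.1 p.2)) ∧
    ∀ c, ¬ Relation.TransGen (K.ReversedArrow M) c c

/-- The basis elements that lie on no arrow of the matching. -/
def criticalStates (M : Set (K.Ω × K.Ω)) : Set K.Ω :=
  {c | ∀ p ∈ M, c ≠ p.1 ∧ c ≠ p.2}

end BasedCochainComplex

end

/-! ### Shellings of a simplicial complex (a down-closed family of finite sets) -/

namespace Shelling

variable {α : Type*} [DecidableEq α]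

/-- The facets of a family `Δ` of finite sets: its maximal members. -/
def IsFacet (Δ : Set (Finset α)) (F : Finset α) : Prop := Maximal (· ∈ Δ) F

/-- `Δ` is a pure simplicial complex and `lt` is a linear order on its facets that is a
shelling order. -/
def IsShelling (Δ : Set (Finset α)) (lt : Finset α → Finset α → Prop) : Prop :=
  Δ.Nonempty ∧ IsLowerSet Δ ∧
  (∀ F F', IsFacet Δ F → IsFacet Δ F' → F.card = F'.card) ∧
  (∀ F, IsFacet Δ F → ¬ lt F F) ∧
  (∀ F₁ F₂ F₃, IsFacet Δ F₁ → IsFacet Δ F₂ → IsFacet Δ F₃ → lt F₁ F₂ → lt F₂ F₃ → lt F₁ F₃) ∧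
  (∀ F F', IsFacet Δ F → IsFacet Δ F' → F ≠ F' → lt F F' ∨ lt F' F) ∧
  ∀ Fi Fj, IsFacet Δ Fi → IsFacet Δ Fj → lt Fi Fj →
    ∃ Fk, IsFacet Δ Fk ∧ lt Fk Fj ∧ ∃ x ∈ Fj, Fi ∩ Fj ⊆ Fk ∩ Fj ∧ Fk ∩ Fj = Fj.erase x

/-- The restriction `𝓡(F)` of a facet `F`: the elements `x ∈ F` such that `F - x` is a face of
some earlier facet. -/
def restriction (Δ : Set (Finset α)) (lt : Finset α → Finset α → Prop) (F : Finset α) : Set α :=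
  {x | x ∈ F ∧ ∃ F', IsFacet Δ F' ∧ lt F' F ∧ F.erase x ⊆ F'}

end Shelling

/-! ### The chromatic complex over `𝓐₂ = ℤ[x]/(x²)` -/

namespace Chromatic

/-- The two colours `1, x`, that is, the standard basis of `ℤ[x]/(x²)`. -/
inductive Color
  | one
  | x
  deriving DecidableEq

namespace Color

/-- The product of two basis elements of `ℤ[x]/(x²)`; `none` stands for the product `0`. -/
def mul : Color → Color → Option Color
  | one, c => some c
  | x, one => some x
  | x, x => none

open Polynomial in
/-- The element of `ℤ[x]/(x²)` named by a colour. -/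
noncomputable def val : Color → AdjoinRoot (X ^ 2 : ℤ[X])
  | one => 1
  | x => AdjoinRoot.root _

theorem val_mul_val (a b : Color) : a.val * b.val = (a.mul b).elim 0 val := by
  have h : AdjoinRoot.root (Polynomial.X ^ 2 : Polynomial ℤ) ^ 2 = 0 := by
    have := AdjoinRoot.eval₂_root (Polynomial.X ^ 2 : Polynomial ℤ)
    simpa using this
  cases a <;> cases b <;> simp [mul, val, ← pow_two, h]

instance : Finite Color :=
  Finite.of_injective (fun c : Color => decide (c = one)) (by
    intro a b; cases a <;> cases b <;> simp)

end Color

variable {V : Type*} {G : SimpleGraph V} {n : ℕ}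

/-- The spanning subgraph of `G` with edges `e_i`, `i ∈ S`. Here and below `O` is an ordering
`e_0 < e_1 < ⋯` of the edges of `G`, and a set of edges is given by the set of its indices. -/
def spanningSubgraph (O : Fin n ≃ G.edgeSet) (S : Finset (Fin n)) : SimpleGraph V :=
  SimpleGraph.fromEdgeSet ((fun i => (O i : Sym2 V)) '' (S : Set (Fin n)))

/-- An enhanced spanning subgraph `(H, ε)`: a set of edges of `G` with a colouring of the
connected components of the spanning subgraph with these edges. -/
structure EnhancedState (O : Fin n ≃ G.edgeSet) where
  /-- the edge set of `H` -/
  edges : Finset (Fin n)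
  /-- the enhancement `ε` -/
  color : (spanningSubgraph O edges).ConnectedComponent → Color

variable {O : Fin n ≃ G.edgeSet}

namespace EnhancedState

/-- The spanning subgraph underlying an enhanced state. -/
abbrev graph (c : EnhancedState O) : SimpleGraph V := spanningSubgraph O c.edges

/-- The colour of the connected component of the vertex `v`. -/
def colorAt (c : EnhancedState O) (v : V) : Color := c.color (c.graph.connectedComponentMk v)

theorem ext' {c c' : EnhancedState O} (h : c.edges = c'.edges)
    (h' : ∀ v, c.colorAt v = c'.colorAt v) : c = c' := by
  obtain ⟨S, f⟩ := c
  obtain ⟨S', f'⟩ := c'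
  obtain rfl : S = S' := h
  congr
  funext C
  induction C using SimpleGraph.ConnectedComponent.ind with
  | h v => exact h' v

theorem colorAt_eq (c : EnhancedState O) {u v : V} (h : c.graph.Reachable u v) :
    c.colorAt u = c.colorAt v := by
  unfold colorAt
  rw [SimpleGraph.ConnectedComponent.eq.2 h]

instance [Finite V] : Finite (EnhancedState O) := by
  refine Finite.of_injective (fun c : EnhancedState O => (c.edges, c.colorAt)) ?_
  intro c c' h
  simp only [Prod.mk.injEq] at h
  exact ext' h.1 (fun v => congrFun h.2 v)

end EnhancedState

/-- `c'` is the state `(H ∪ e, ε_e)` obtained from `c = (H, ε)` by adding the edge `e = e_i`: if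
`e` joins two vertices of one component, all colours are kept; if it joins two components, their
union is coloured by the product of their colours and the other components keep theirs.
There is no such `c'` exactly when that product is `0`. -/
def IsEdgeImage (c : EnhancedState O) (i : Fin n) (c' : EnhancedState O) : Prop :=
  c'.edges = insert i c.edges ∧
  ∀ u v : V, (O i : Sym2 V) = s(u, v) →
    (c.graph.Reachable u v → ∀ w, c'.colorAt w = c.colorAt w) ∧
    (¬ c.graph.Reachable u v →
      (∀ w, ¬ c.graph.Reachable u w → ¬ c.graph.Reachable v w → c'.colorAt w = c.colorAt w) ∧
      (c.colorAt u).mul (c.colorAt v) = some (c'.colorAt u))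

/-- The sign `(-1)^{#{f ∈ S : f < e_i}}`. -/
def edgeSign (S : Finset (Fin n)) (i : Fin n) : ℤ := (-1) ^ (S.filter (· < i)).card

/-- The per-edge map `d^e (H, ε) = (H ∪ e, ε_e)`, `e = e_i`, read as `0` if the product of colours
is `0`: the sum below has at most one term. -/
noncomputable def perEdge [Finite V] (i : Fin n) (c : EnhancedState O) : EnhancedState O →₀ ℤ :=
  ∑ c' ∈ (Set.toFinite {c' | IsEdgeImage c i c'}).toFinset, Finsupp.single c' 1

/-- The differential of the chromatic complex,
`d (H, ε) = ∑_{e ∉ H} (-1)^e (H ∪ e, ε_e)`. -/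
noncomputable def differential [Finite V] (O : Fin n ≃ G.edgeSet) :
    (EnhancedState O →₀ ℤ) →ₗ[ℤ] (EnhancedState O →₀ ℤ) :=
  Finsupp.linearCombination ℤ fun c => ∑ i ∈ c.edgesᶜ, edgeSign c.edges i • perEdge i c

/-! #### The differential squares to zero -/

theorem spanningSubgraph_mono {S S' : Finset (Fin n)} (h : S ⊆ S') :
    spanningSubgraph O S ≤ spanningSubgraph O S' :=
  SimpleGraph.fromEdgeSet_mono (Set.image_mono (by exact_mod_cast h))

theorem reachable_mono {S S' : Finset (Fin n)} (h : S ⊆ S') {u v : V}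
    (huv : (spanningSubgraph O S).Reachable u v) : (spanningSubgraph O S').Reachable u v :=
  huv.mono (spanningSubgraph_mono h)

theorem adj_iff {S : Finset (Fin n)} {u v : V} :
    (spanningSubgraph O S).Adj u v ↔ ∃ i ∈ S, (O i : Sym2 V) = s(u, v) := by
  simp only [spanningSubgraph, SimpleGraph.fromEdgeSet_adj, Set.mem_image, Finset.mem_coe]
  refine ⟨fun h => h.1, fun h => ⟨h, ?_⟩⟩
  obtain ⟨i, -, hi⟩ := h
  have := (O i).2
  rw [hi, SimpleGraph.mem_edgeSet] at this
  exact this.ne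

theorem reachable_insert {S : Finset (Fin n)} {i : Fin n} {u v : V} (hi : (O i : Sym2 V) = s(u, v))
    {a b : V} (h : (spanningSubgraph O (insert i S)).Reachable a b) :
    (spanningSubgraph O S).Reachable a b ∨
      ((spanningSubgraph O S).Reachable u a ∧ (spanningSubgraph O S).Reachable v b) ∨
      ((spanningSubgraph O S).Reachable v a ∧ (spanningSubgraph O S).Reachable u b) := by
  obtain ⟨p⟩ := h
  induction p with
  | nil => exact Or.inl (SimpleGraph.Reachable.refl _)
  | @cons a b c hab p ih =>
    have key : (spanningSubgraph O S).Reachable a b ∨ (a = u ∧ b = v) ∨ (a = v ∧ b = u) := by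
      obtain ⟨j, hj, hj'⟩ := adj_iff.1 hab
      rcases Finset.mem_insert.1 hj with rfl | hj
      · rw [hi, Sym2.eq_iff] at hj'
        rcases hj' with ⟨rfl, rfl⟩ | ⟨rfl, rfl⟩ <;> simp
      · exact Or.inl (adj_iff.2 ⟨j, hj, hj'⟩).reachable
    rcases key with h | ⟨rfl, rfl⟩ | ⟨rfl, rfl⟩
    · rcases ih with ih | ⟨h1, h2⟩ | ⟨h1, h2⟩
      · exact Or.inl (h.trans ih)
      · exact Or.inr (Or.inl ⟨h1.trans h.symm, h2⟩)
      · exact Or.inr (Or.inr ⟨h1.trans h.symm, h2⟩)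
    · rcases ih with ih | ⟨h1, h2⟩ | ⟨h1, h2⟩
      · exact Or.inr (Or.inl ⟨.refl _, ih⟩)
      · exact Or.inr (Or.inl ⟨.refl _, h2⟩)
      · exact Or.inl h2
    · rcases ih with ih | ⟨h1, h2⟩ | ⟨h1, h2⟩
      · exact Or.inr (Or.inr ⟨.refl _, ih⟩)
      · exact Or.inl h2
      · exact Or.inr (Or.inr ⟨.refl _, h2⟩)

/-- The components coloured `x` in `c` are sent bijectively onto those coloured `x` in `c'`. -/
def Transfer (c c' : EnhancedState O) : Prop :=
  (∀ w, c.colorAt w = .x → c'.colorAt w = .x) ∧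
  (∀ w w', c.colorAt w = .x → c.colorAt w' = .x → c'.graph.Reachable w w' →
    c.graph.Reachable w w') ∧
  ∀ w, c'.colorAt w = .x → ∃ w', c'.graph.Reachable w w' ∧ c.colorAt w' = .x

theorem Color.eq_iff_x {a b : Color} (h : a = .x ↔ b = .x) : a = b := by
  cases a <;> cases b <;> simp_all

theorem Transfer.colorAt_eq_x {c c' : EnhancedState O} (h : Transfer c c') (w : V) :
    c'.colorAt w = .x ↔ ∃ w', c'.graph.Reachable w w' ∧ c.colorAt w' = .x :=
  ⟨h.2.2 w, fun ⟨w', h1, h2⟩ => by rw [c'.colorAt_eq h1]; exact h.1 w' h2⟩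

theorem isEdgeImage_iff {c c' : EnhancedState O} {i : Fin n} :
    IsEdgeImage c i c' ↔ c'.edges = insert i c.edges ∧ Transfer c c' := by
  unfold IsEdgeImage
  refine and_congr_right fun hE => ?_
  obtain ⟨u, v, huv⟩ : ∃ u v, (O i : Sym2 V) = s(u, v) := by
    induction h : (O i : Sym2 V) with
    | h u v => exact ⟨u, v, rfl⟩
  have hmono : ∀ {a b}, c.graph.Reachable a b → c'.graph.Reachable a b := fun h => by
    refine reachable_mono ?_ h
    rw [hE]; exact Finset.subset_insert _ _
  have huv' : c'.graph.Reachable u v :=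
    (adj_iff.2 ⟨i, by rw [hE]; exact Finset.mem_insert_self _ _, huv⟩).reachable
  have hins : ∀ {a b}, c'.graph.Reachable a b → c.graph.Reachable a b ∨
      (c.graph.Reachable u a ∧ c.graph.Reachable v b) ∨
      (c.graph.Reachable v a ∧ c.graph.Reachable u b) := fun h => by
    refine reachable_insert huv ?_
    rw [EnhancedState.graph, hE] at h
    exact h
  constructor
  · intro h
    obtain ⟨h1, h2⟩ := h u v huv
    by_cases hr : c.graph.Reachable u v
    · have h1 := h1 hr
      refine ⟨fun w hw => by rw [h1, hw], fun w w' _ _ hww => ?_, fun w hw =>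
        ⟨w, .refl _, by rw [← h1, hw]⟩⟩
      rcases hins hww with h | ⟨ha, hb⟩ | ⟨ha, hb⟩
      · exact h
      · exact ha.symm.trans (hr.trans hb)
      · exact ha.symm.trans (hr.symm.trans hb)
    · obtain ⟨h2, h3⟩ := h2 hr
      have hvx : c'.colorAt v = c'.colorAt u := (c'.colorAt_eq huv').symm
      have hux : c'.colorAt u = .x ↔ c.colorAt u = .x ∨ c.colorAt v = .x := by
        cases hcu : c.colorAt u <;> cases hcv : c.colorAt v <;> simp_all [Color.mul]
      have hnot : ¬ (c.colorAt u = .x ∧ c.colorAt v = .x) := by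
        rintro ⟨hcu, hcv⟩
        rw [hcu, hcv] at h3
        simp [Color.mul] at h3
      refine ⟨fun w hw => ?_, fun w w' hw hw' hww => ?_, fun w hw => ?_⟩
      · by_cases hu : c.graph.Reachable u w
        · rw [← c'.colorAt_eq (hmono hu), hux, c.colorAt_eq hu]; exact Or.inl hw
        by_cases hv : c.graph.Reachable v w
        · rw [← c'.colorAt_eq (hmono hv), hvx, hux, c.colorAt_eq hv]; exact Or.inr hw
        rw [h2 w hu hv, hw]
      · rcases hins hww with h | ⟨ha, hb⟩ | ⟨ha, hb⟩
        · exact h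
        · exact absurd ⟨by rw [c.colorAt_eq ha, hw], by rw [c.colorAt_eq hb, hw']⟩ hnot
        · exact absurd ⟨by rw [c.colorAt_eq hb, hw'], by rw [c.colorAt_eq ha, hw]⟩ hnot
      · by_cases hu : c'.graph.Reachable u w
        · rw [← c'.colorAt_eq hu, hux] at hw
          rcases hw with hw | hw
          · exact ⟨u, hu.symm, hw⟩
          · exact ⟨v, hu.symm.trans huv', hw⟩
        · refine ⟨w, .refl _, ?_⟩
          rw [← h2 w (fun h => hu (hmono h)) (fun h => hu (huv'.trans (hmono h))), hw]
  · intro hT u₀ v₀ huv₀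
    clear huv huv' hins
    have huv' : c'.graph.Reachable u₀ v₀ :=
      (adj_iff.2 ⟨i, by rw [hE]; exact Finset.mem_insert_self _ _, huv₀⟩).reachable
    have hins : ∀ {a b}, c'.graph.Reachable a b → c.graph.Reachable a b ∨
        (c.graph.Reachable u₀ a ∧ c.graph.Reachable v₀ b) ∨
        (c.graph.Reachable v₀ a ∧ c.graph.Reachable u₀ b) := fun h => by
      refine reachable_insert huv₀ ?_
      rw [EnhancedState.graph, hE] at h
      exact h
    refine ⟨fun hr w => Color.eq_iff_x ⟨fun hw => ?_, hT.1 w⟩, fun hr =>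
      ⟨fun w hu hv => Color.eq_iff_x ⟨fun hw => ?_, hT.1 w⟩, ?_⟩⟩
    · obtain ⟨w', h1, h2⟩ := hT.2.2 w hw
      rw [← h2]
      refine c.colorAt_eq ?_
      rcases hins h1 with h | ⟨ha, hb⟩ | ⟨ha, hb⟩
      · exact h
      · exact ha.symm.trans (hr.trans hb)
      · exact ha.symm.trans (hr.symm.trans hb)
    · obtain ⟨w', h1, h2⟩ := hT.2.2 w hw
      rw [← h2]
      refine c.colorAt_eq ?_
      rcases hins h1 with h | ⟨ha, hb⟩ | ⟨ha, hb⟩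
      · exact h
      · exact absurd ha hu
      · exact absurd ha hv
    · have hux : c'.colorAt u₀ = .x ↔ c.colorAt u₀ = .x ∨ c.colorAt v₀ = .x := by
        constructor
        · intro hw
          obtain ⟨w', h1, h2⟩ := hT.2.2 _ hw
          rcases hins h1 with h | ⟨ha, hb⟩ | ⟨ha, hb⟩
          · left; rw [c.colorAt_eq h, h2]
          · right; rw [c.colorAt_eq hb, h2]
          · left; rw [c.colorAt_eq hb, h2]
        · rintro (h | h)
          · exact hT.1 _ h
          · rw [c'.colorAt_eq huv']; exact hT.1 _ h
      have hnot : ¬ (c.colorAt u₀ = .x ∧ c.colorAt v₀ = .x) := fun h =>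
        hr (hT.2.1 _ _ h.1 h.2 huv')
      cases hcu : c.colorAt u₀ <;> cases hcv : c.colorAt v₀ <;>
        cases hcu' : c'.colorAt u₀ <;> simp_all [Color.mul]

theorem IsEdgeImage.unique {c c₁ c₂ : EnhancedState O} {i : Fin n} (h₁ : IsEdgeImage c i c₁)
    (h₂ : IsEdgeImage c i c₂) : c₁ = c₂ := by
  rw [isEdgeImage_iff] at h₁ h₂
  have hE : c₁.edges = c₂.edges := h₁.1.trans h₂.1.symm
  refine EnhancedState.ext' hE fun v => Color.eq_iff_x ?_
  rw [h₁.2.colorAt_eq_x, h₂.2.colorAt_eq_x, EnhancedState.graph, EnhancedState.graph, hE]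

theorem Transfer.trans {c c' c'' : EnhancedState O} (hE : c'.edges ⊆ c''.edges)
    (h : Transfer c c') (h' : Transfer c' c'') : Transfer c c'' := by
  refine ⟨fun w hw => h'.1 w (h.1 w hw), fun w w' hw hw' hr =>
    h.2.1 w w' hw hw' (h'.2.1 w w' (h.1 w hw) (h.1 w' hw') hr), fun w hw => ?_⟩
  obtain ⟨w', h1, h2⟩ := h'.2.2 w hw
  obtain ⟨w'', h3, h4⟩ := h.2.2 w' h2
  exact ⟨w'', h1.trans (reachable_mono hE h3), h4⟩

open Classical in
theorem Transfer.factor {c c'' : EnhancedState O} {S : Finset (Fin n)} (h1 : c.edges ⊆ S)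
    (h2 : S ⊆ c''.edges) (h : Transfer c c'') :
    ∃ c' : EnhancedState O, c'.edges = S ∧ Transfer c c' ∧ Transfer c' c'' := by
  let c' : EnhancedState O := ⟨S, fun C => if ∃ w', (spanningSubgraph O S).connectedComponentMk w' = C
    ∧ c.colorAt w' = .x then .x else .one⟩
  have hc' : ∀ w, c'.colorAt w = .x ↔ ∃ w', c'.graph.Reachable w w' ∧ c.colorAt w' = .x := by
    intro w
    have : c'.colorAt w = if ∃ w', (spanningSubgraph O S).connectedComponentMk w' =
      (spanningSubgraph O S).connectedComponentMk w ∧ c.colorAt w' = .x then .x else .one := rfl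
    rw [this]
    simp only [SimpleGraph.ConnectedComponent.eq]
    split_ifs with hh
    · simp only [true_iff]
      obtain ⟨w', h1, h2⟩ := hh
      exact ⟨w', h1.symm, h2⟩
    · simp only [false_iff]
      rintro ⟨w', h1, h2⟩
      exact hh ⟨w', h1.symm, h2⟩
  have m2 : ∀ {a b}, c'.graph.Reachable a b → c''.graph.Reachable a b :=
    fun h => reachable_mono h2 h
  have m1 : ∀ {a b}, c.graph.Reachable a b → c'.graph.Reachable a b :=
    fun h => reachable_mono h1 h
  have hx : ∀ w, c.colorAt w = .x → c'.colorAt w = .x :=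
    fun w hw => (hc' w).2 ⟨w, .refl _, hw⟩
  refine ⟨c', rfl, ⟨hx, fun w w' hw hw' hr => h.2.1 w w' hw hw' (m2 hr),
    fun w hw => (hc' w).1 hw⟩, fun w hw => ?_, fun w w' hw hw' hr => ?_, fun w hw => ?_⟩
  · obtain ⟨w', h3, h4⟩ := (hc' w).1 hw
    rw [c''.colorAt_eq (m2 h3)]
    exact h.1 _ h4
  · obtain ⟨w₁, h3, h4⟩ := (hc' w).1 hw
    obtain ⟨w₂, h5, h6⟩ := (hc' w').1 hw'
    have := h.2.1 _ _ h4 h6 ((m2 h3).symm.trans (hr.trans (m2 h5)))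
    exact h3.trans ((m1 this).trans h5.symm)
  · obtain ⟨w', h3, h4⟩ := h.2.2 w hw
    exact ⟨w', h3, hx _ h4⟩

theorem isEdgeImage_comm {c c'' : EnhancedState O} {i j : Fin n} :
    (∃ c', IsEdgeImage c i c' ∧ IsEdgeImage c' j c'') →
      ∃ c', IsEdgeImage c j c' ∧ IsEdgeImage c' i c'' := by
  rintro ⟨c', h1, h2⟩
  rw [isEdgeImage_iff] at h1 h2
  have hE : c''.edges = insert i (insert j c.edges) := by
    rw [h2.1, h1.1, Finset.insert_comm]
  obtain ⟨c₁, h3, h4, h5⟩ := Transfer.factor (S := insert j c.edges) (Finset.subset_insert _ _)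
    (by rw [hE]; exact Finset.subset_insert _ _)
    (h1.2.trans (by rw [h2.1]; exact Finset.subset_insert _ _) h2.2)
  exact ⟨c₁, isEdgeImage_iff.2 ⟨h3, h4⟩, isEdgeImage_iff.2 ⟨by rw [hE, h3], h5⟩⟩

theorem edgeSign_anticomm {S : Finset (Fin n)} {i j : Fin n} (hi : i ∉ S) (hj : j ∉ S)
    (hij : i ≠ j) :
    edgeSign S i * edgeSign (insert i S) j = - (edgeSign S j * edgeSign (insert j S) i) := by
  wlog h : i < j generalizing i j
  · rw [this hj hi hij.symm (lt_of_le_of_ne (not_lt.1 h) hij.symm), neg_neg]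
  have h1 : (insert i S).filter (· < j) = insert i (S.filter (· < j)) := by
    rw [Finset.filter_insert, if_pos h]
  have h2 : (insert j S).filter (· < i) = S.filter (· < i) := by
    rw [Finset.filter_insert, if_neg (not_lt.2 h.le)]
  unfold edgeSign
  rw [h1, h2, Finset.card_insert_of_notMem (by simp [hi])]
  ring

open Classical in
theorem perEdge_apply [Finite V] (i : Fin n) (c c' : EnhancedState O) :
    perEdge i c c' = if IsEdgeImage c i c' then 1 else 0 := by
  simp [perEdge, Finsupp.finsetSum_apply, Finsupp.single_apply]

theorem differential_single [Finite V] (c : EnhancedState O) :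
    differential O (Finsupp.single c 1) =
      ∑ i ∈ c.edgesᶜ, edgeSign c.edges i • perEdge i c := by
  simp [differential]

theorem exists_of_differential_ne_zero [Finite V] {c c' : EnhancedState O}
    (h : differential O (Finsupp.single c 1) c' ≠ 0) :
    ∃ i ∉ c.edges, IsEdgeImage c i c' := by
  classical
  rw [differential_single, Finsupp.finsetSum_apply] at h
  obtain ⟨i, hi, h'⟩ := Finset.exists_ne_zero_of_sum_ne_zero h
  refine ⟨i, by simpa using hi, ?_⟩
  by_contra hc
  simp [perEdge_apply, hc] at h'

theorem differential_comp_self [Finite V] (O : Fin n ≃ G.edgeSet) :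
    differential O ∘ₗ differential O = 0 := by
  classical
  refine Finsupp.lhom_ext' fun c => LinearMap.ext_ring ?_
  simp only [LinearMap.comp_apply, Finsupp.lsingle_apply, LinearMap.zero_apply]
  ext c''
  have hstep : ∀ i ∈ c.edgesᶜ, differential O (perEdge i c) c'' =
      ∑ j ∈ (insert i c.edges)ᶜ, edgeSign (insert i c.edges) j *
        (if ∃ c', IsEdgeImage c i c' ∧ IsEdgeImage c' j c'' then 1 else 0) := by
    intro i _
    by_cases hex : ∃ c', IsEdgeImage c i c'
    · obtain ⟨c', hc'⟩ := hex
      have : perEdge i c = Finsupp.single c' 1 := by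
        ext b
        rw [perEdge_apply, Finsupp.single_apply]
        refine if_congr ⟨fun h => hc'.unique h, fun h => h ▸ hc'⟩ rfl rfl
      rw [this, differential_single, Finsupp.finsetSum_apply, hc'.1]
      refine Finset.sum_congr rfl fun j _ => ?_
      rw [Finsupp.smul_apply, perEdge_apply, smul_eq_mul]
      congr 1
      refine if_congr ⟨fun h => ⟨c', hc', h⟩, fun ⟨b, h1, h2⟩ => ?_⟩ rfl rfl
      rwa [hc'.unique h1]
    · have : perEdge i c = 0 := by
        ext b
        rw [perEdge_apply, if_neg fun h => hex ⟨b, h⟩, Finsupp.zero_apply]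
      rw [this, map_zero, Finsupp.zero_apply]
      refine (Finset.sum_eq_zero fun j _ => ?_).symm
      rw [if_neg fun ⟨b, h, _⟩ => hex ⟨b, h⟩, mul_zero]
  set P : Fin n → Fin n → ℤ := fun i j =>
    if ∃ c', IsEdgeImage c i c' ∧ IsEdgeImage c' j c'' then 1 else 0
  have hPcomm : ∀ i j, P i j = P j i := fun i j =>
    if_congr ⟨isEdgeImage_comm, isEdgeImage_comm⟩ rfl rfl
  set F : Fin n → Fin n → ℤ := fun i j =>
    if i ∉ c.edges ∧ j ∉ c.edges ∧ i ≠ j then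
      edgeSign c.edges i * edgeSign (insert i c.edges) j * P i j else 0 with hF
  have hFanti : ∀ i j, F i j = - F j i := by
    intro i j
    simp only [hF]
    by_cases h : i ∉ c.edges ∧ j ∉ c.edges ∧ i ≠ j
    · rw [if_pos h, if_pos ⟨h.2.1, h.1, h.2.2.symm⟩, edgeSign_anticomm h.1 h.2.1 h.2.2,
        hPcomm i j, neg_mul]
    · rw [if_neg h, if_neg fun h' => h ⟨h'.2.1, h'.1, h'.2.2.symm⟩, neg_zero]
  have hsum : differential O (differential O (Finsupp.single c 1)) c'' = ∑ i, ∑ j, F i j := by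
    rw [differential_single, map_sum, Finsupp.finsetSum_apply, ← Finset.sum_subset
      (Finset.subset_univ c.edgesᶜ)]
    · refine Finset.sum_congr rfl fun i hi => ?_
      rw [map_smul, Finsupp.smul_apply, hstep i hi, smul_eq_mul, Finset.mul_sum,
        ← Finset.sum_subset (Finset.subset_univ (insert i c.edges)ᶜ)]
      · refine Finset.sum_congr rfl fun j hj => ?_
        simp only [Finset.mem_compl, Finset.mem_insert, not_or] at hi hj
        have hFij : F i j = edgeSign c.edges i * edgeSign (insert i c.edges) j * P i j :=
          if_pos ⟨hi, hj.2, Ne.symm hj.1⟩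
        rw [hFij, mul_assoc]
      · intro j _ hj
        simp only [Finset.mem_compl, Finset.mem_insert, not_not] at hj
        simp only [hF]
        refine if_neg fun h => ?_
        rcases hj with hj | hj
        · exact h.2.2 hj.symm
        · exact h.2.1 hj
    · intro i _ hi
      refine Finset.sum_eq_zero fun j _ => if_neg fun h => ?_
      simp only [Finset.mem_compl, not_not] at hi
      exact h.1 hi
  rw [hsum, Finsupp.zero_apply]
  have : ∑ i, ∑ j, F i j = - ∑ i, ∑ j, F i j := by
    conv_lhs => rw [Finset.sum_comm]
    rw [← Finset.sum_neg_distrib]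
    refine Finset.sum_congr rfl fun i _ => ?_
    rw [← Finset.sum_neg_distrib]
    exact Finset.sum_congr rfl fun j _ => hFanti _ _
  omega

/-- The chromatic complex of `G` over `ℤ[x]/(x²)`, with the enhanced spanning subgraphs as
basis, graded by the number of edges. -/
noncomputable def chromaticComplex [Finite V] (O : Fin n ≃ G.edgeSet) : BasedCochainComplex ℤ where
  Ω := EnhancedState O
  deg c := c.edges.card
  d := differential O
  deg_of_d_ne_zero c c' h := by
    obtain ⟨i, hi, h'⟩ := exists_of_differential_ne_zero h
    rw [h'.1, Finset.card_insert_of_notMem hi]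
  d_comp_d := differential_comp_self O

/-! ### Broken circuits and the NBC complex -/

/-- `C` is the edge set of a cycle of `G`. -/
def IsCycleEdgeSet (O : Fin n ≃ G.edgeSet) (C : Finset (Fin n)) : Prop :=
  ∃ (v : V) (p : G.Walk v v), p.IsCycle ∧ ∀ i, i ∈ C ↔ (O i : Sym2 V) ∈ p.edges

/-- A broken circuit: a cycle with its least edge removed. -/
def IsBrokenCircuit (O : Fin n ≃ G.edgeSet) (B : Finset (Fin n)) : Prop :=
  ∃ C i, IsCycleEdgeSet O C ∧ IsLeast (C : Set (Fin n)) i ∧ B = C.erase i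

/-- The complex `NBC` of the sets of edges that contain no broken circuit. -/
def NBC (O : Fin n ≃ G.edgeSet) : Set (Finset (Fin n)) :=
  {S | ∀ B, IsBrokenCircuit O B → ¬ B ⊆ S}

theorem nbc_mono {S S' : Finset (Fin n)} (h : S ⊆ S') (h' : S' ∈ NBC O) : S ∈ NBC O :=
  fun B hB hBS => h' B hB (hBS.trans h)

/-- The set of enhanced NBC spanning subgraphs. -/
def nbcStates (O : Fin n ≃ G.edgeSet) : Set (EnhancedState O) := {c | c.edges ∈ NBC O}

/-- The restriction of the chromatic differential to the enhanced NBC spanning subgraphs: terms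
that are not NBC are dropped. -/
noncomputable def nbcDifferential [Finite V] (O : Fin n ≃ G.edgeSet) :
    (nbcStates O →₀ ℤ) →ₗ[ℤ] (nbcStates O →₀ ℤ) :=
  Finsupp.lsubtypeDomain (nbcStates O) ∘ₗ differential O ∘ₗ
    Finsupp.lmapDomain ℤ ℤ ((↑) : nbcStates O → EnhancedState O)

theorem nbcDifferential_single_apply [Finite V] (c c' : nbcStates O) :
    nbcDifferential O (Finsupp.single c 1) c' =
      differential O (Finsupp.single (c : EnhancedState O) 1) (c' : EnhancedState O) := by
  simp [nbcDifferential, Finsupp.lsubtypeDomain_apply, Finsupp.mapDomain_single]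

theorem nbcDifferential_lsubtypeDomain [Finite V] (f : EnhancedState O →₀ ℤ) :
    nbcDifferential O (Finsupp.lsubtypeDomain (R := ℤ) (nbcStates O) f) =
      Finsupp.lsubtypeDomain (R := ℤ) (nbcStates O) (differential O f) := by
  classical
  induction f using Finsupp.induction_linear with
  | zero => simp
  | add f g hf hg => simp only [map_add, hf, hg]
  | single c r =>
    have hs : Finsupp.single c r = r • Finsupp.single c (1 : ℤ) := by simp
    rw [hs]
    simp only [map_smul]
    congr 1
    by_cases hc : c ∈ nbcStates O
    · have : Finsupp.lsubtypeDomain (R := ℤ) (nbcStates O) (Finsupp.single c (1 : ℤ)) =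
          Finsupp.single (⟨c, hc⟩ : nbcStates O) 1 := by
        ext b
        simp [Finsupp.lsubtypeDomain_apply, Finsupp.single_apply, Subtype.ext_iff]
      rw [this]
      ext b
      rw [nbcDifferential_single_apply]
      rfl
    · have : Finsupp.lsubtypeDomain (R := ℤ) (nbcStates O) (Finsupp.single c (1 : ℤ)) = 0 := by
        ext b
        have : c ≠ b := fun h => hc (h ▸ b.2)
        simp [Finsupp.lsubtypeDomain_apply, this]
      rw [this, map_zero]
      ext b
      by_contra hne
      have hne' : differential O (Finsupp.single c 1) (b : EnhancedState O) ≠ 0 :=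
        fun h => hne h.symm
      obtain ⟨i, -, h⟩ := exists_of_differential_ne_zero hne'
      refine hc (nbc_mono ?_ b.2)
      rw [h.1]
      exact Finset.subset_insert _ _

/-- The NBC complex: the chromatic complex restricted to the enhanced NBC spanning subgraphs. -/
noncomputable def nbcComplex [Finite V] (O : Fin n ≃ G.edgeSet) : BasedCochainComplex ℤ where
  Ω := nbcStates O
  deg c := c.1.edges.card
  d := nbcDifferential O
  deg_of_d_ne_zero c c' h := by
    rw [nbcDifferential_single_apply] at h
    obtain ⟨i, hi, h'⟩ := exists_of_differential_ne_zero h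
    rw [h'.1, Finset.card_insert_of_notMem hi]
  d_comp_d := by
    refine LinearMap.ext fun f => ?_
    have h := nbcDifferential_lsubtypeDomain
      (differential O (Finsupp.lmapDomain ℤ ℤ ((↑) : nbcStates O → EnhancedState O) f))
    have h0 : ∀ g, differential O (differential O g) = 0 := fun g =>
      LinearMap.congr_fun (differential_comp_self O) g
    rw [h0, map_zero] at h
    exact h

/-! ### NBC spanning trees, activities, and the signed states -/

/-- An NBC spanning tree of `G`. -/
def IsNBCTree (O : Fin n ≃ G.edgeSet) (T : Finset (Fin n)) : Prop :=
  (spanningSubgraph O T).IsTree ∧ T ∈ NBC O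

/-- The lexicographic order: the edges of `S` and `T`, each listed in increasing order, are
compared at the first place where they differ. -/
def LexLT (S T : Finset (Fin n)) : Prop := S.sort (· ≤ ·) < T.sort (· ≤ ·)

/-- `cut(T, e)`: the edges of `G` that reconnect `T ∖ e`. -/
def cut (O : Fin n ≃ G.edgeSet) (T : Finset (Fin n)) (i : Fin n) : Set (Fin n) :=
  {j | (spanningSubgraph O (insert j (T.erase i))).Connected}

open Classical in
/-- `IN(T)`: the edges `e` of `T` that are internally inactive, that is, not the smallest edge of
`cut(T, e)`. -/
noncomputable def inactive (O : Fin n ≃ G.edgeSet) (T : Finset (Fin n)) : Finset (Fin n) :=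
  {i ∈ T | ¬ IsLeast (cut O T i) i}

/-- The two signs of a signed tree. -/
inductive TreeSign
  | plus
  | minus
  deriving DecidableEq

open Classical in
/-- The state `H^{T^±}` with edge set `IN(T)`: all components are coloured `x`, except that for
the sign `+` the component of the root `r` is coloured `1`. -/
noncomputable def signedState (O : Fin n ≃ G.edgeSet) (r : V) (T : Finset (Fin n)) :
    TreeSign → EnhancedState O
  | .plus => ⟨inactive O T, fun C =>
      if C = (spanningSubgraph O (inactive O T)).connectedComponentMk r then .one else .x⟩
  | .minus => ⟨inactive O T, fun _ => .x⟩

theorem inactive_subset (T : Finset (Fin n)) : inactive O T ⊆ T := by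
  classical
  intro i hi
  unfold inactive at hi
  exact (Finset.mem_filter.1 hi).1

theorem signedState_edges (r : V) (T : Finset (Fin n)) (s : TreeSign) :
    (signedState O r T s).edges = inactive O T := by
  cases s <;> rfl

/-- The critical state `H^{T^±}` of a signed NBC spanning tree, as a basis element of the NBC
complex. -/
noncomputable def signedTreeState [Finite V] (O : Fin n ≃ G.edgeSet) (r : V)
    (Ts : {T : Finset (Fin n) // IsNBCTree O T} × TreeSign) : (nbcComplex O).Ω :=
  ⟨signedState O r Ts.1.1 Ts.2, by
    show (signedState O r Ts.1.1 Ts.2).edges ∈ NBC O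
    rw [signedState_edges]
    exact nbc_mono (inactive_subset _) Ts.1.2.2⟩

/-- The edge set of a basis element of the NBC complex. -/
def nbcEdges [Finite V] {O : Fin n ≃ G.edgeSet} (c : (nbcComplex O).Ω) : Finset (Fin n) :=
  EnhancedState.edges (Subtype.val c)

end Chromatic

/-!
The whole argument uses reachability in spanning subgraphs instead of circuits: an edge set is NBC
iff no edge of the graph has its ends joined by larger edges of the set (`mem_nbc_iff`).

*Facets and shelling.* Adding to an NBC set the least edge that joins two of its components keeps
it NBC (`insert_mem_nbc`), so the facets are the NBC spanning trees. Two exchange statements carry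
the rest. If `x ∈ IN(T)`, replacing `x` by the least edge of `cut(T, x)` gives an earlier NBC tree
containing `T - x` (`IsNBCTree.exists_lexLT`). If `T'` is an earlier NBC tree than `T`, some
`x ∈ IN(T)` is not in `T'` (`IsNBCTree.exists_mem_inactive`). Hence the order is a shelling, the
restriction of `T` is `IN(T)`, and the interval containing `S` is `[IN(T), T]` with `T` the first
NBC tree that contains `S`. In particular `T` depends monotonically on `S`.

*Matching.* Within the interval of `T`, root `T` at `r`. Every edge `i ∈ T` has a lower end
`child i`, and the components of a state are headed by `r` and by the `child i` for the missing
edges `i ∈ T`. Removing an edge `i` while colouring the new lower component `1`, and adding a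
missing edge `i` whose lower component is coloured `1`, are inverse to each other, since `1` is the
unit of the product. The matching toggles the least edge outside `IN(T)` for which one of the two is
possible (`togglable`). No toggle changes the set of togglable edges
(`IsEdgeImage.togglable_eq`), so this is a matching. A state is critical iff no edge is togglable,
that is, iff its edge set is `IN(T)` and all components except possibly that of `r` are coloured
`x`: these are the signed trees.

*Acyclicity.* `rank` increases along every arrow of the modified graph. Arrows of the complex do
not lower the tree of the interval. Within an interval, adding an edge with lower component coloured
`x` moves this `x` to a higher component (`IsEdgeImage.xWeight_lt`); adding one with lower
component coloured `1` changes neither the weight nor the togglable edges. So along a cycle the tree,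
the weight and the least togglable edge `k` would be constant. A reversed arrow removes `k`, and an
arrow that is not reversed adds an edge different from `k`, so `k` is never regained; a cycle would
thus only add edges, which is impossible.
-/

namespace Chromatic

variable {V : Type*} {G : SimpleGraph V} {n : ℕ} {O : Fin n ≃ G.edgeSet}

/-! ### Circuits and reachability -/

theorem exists_ends (O : Fin n ≃ G.edgeSet) (i : Fin n) : ∃ u v, (O i : Sym2 V) = s(u, v) := by
  induction h : (O i : Sym2 V) with
  | h u v => exact ⟨u, v, rfl⟩

theorem ends_ne {i : Fin n} {u v : V} (h : (O i : Sym2 V) = s(u, v)) : u ≠ v := by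
  have := (O i).2
  rw [h, SimpleGraph.mem_edgeSet] at this
  exact this.ne

theorem reachable_ends {S : Finset (Fin n)} {i : Fin n} (hi : i ∈ S) {u v : V}
    (h : (O i : Sym2 V) = s(u, v)) : (spanningSubgraph O S).Reachable u v :=
  (adj_iff.2 ⟨i, hi, h⟩).reachable

theorem spanningSubgraph_le (S : Finset (Fin n)) : spanningSubgraph O S ≤ G := by
  intro a b h
  obtain ⟨i, -, hi⟩ := adj_iff.1 h
  have := (O i).2
  rwa [hi, SimpleGraph.mem_edgeSet] at this

theorem exists_isCycleEdgeSet_of_reachable {S : Finset (Fin n)} {i : Fin n} {u v : V}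
    (h : (O i : Sym2 V) = s(u, v)) (hi : i ∉ S) (hr : (spanningSubgraph O S).Reachable u v) :
    ∃ C, IsCycleEdgeSet O C ∧ i ∈ C ∧ C ⊆ insert i S := by
  classical
  set H := spanningSubgraph O (insert i S)
  have hadj : H.Adj u v := adj_iff.2 ⟨i, Finset.mem_insert_self _ _, h⟩
  have hle : spanningSubgraph O S ≤ H \ SimpleGraph.fromEdgeSet {s(u, v)} := by
    intro a b hab
    obtain ⟨j, hj, hj'⟩ := adj_iff.1 hab
    refine ⟨adj_iff.2 ⟨j, Finset.mem_insert_of_mem hj, hj'⟩, fun hc => hi ?_⟩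
    have hc' : s(a, b) = s(u, v) := hc.1
    have : O i = O j := Subtype.ext (by rw [h, hj', hc'])
    rwa [O.injective this]
  obtain ⟨x, p, hp, hpe⟩ := SimpleGraph.adj_and_reachable_delete_edges_iff_exists_cycle.1
    ⟨hadj, hr.mono hle⟩
  refine ⟨Finset.univ.filter fun j => (O j : Sym2 V) ∈ p.edges,
    ⟨x, p.mapLe (spanningSubgraph_le _), hp.mapLe _, fun j => ?_⟩, ?_, fun j hj => ?_⟩
  · simp
  · simpa [h] using hpe
  · have := p.edges_subset_edgeSet (Finset.mem_filter.1 hj).2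
    induction hh : (O j : Sym2 V) with
    | h a b =>
      rw [hh, SimpleGraph.mem_edgeSet] at this
      obtain ⟨k, hk, hk'⟩ := adj_iff.1 this
      have : O j = O k := Subtype.ext (by rw [hh, hk'])
      rwa [O.injective this]

theorem IsCycleEdgeSet.reachable_erase {C : Finset (Fin n)} (hC : IsCycleEdgeSet O C) {i : Fin n}
    (hi : i ∈ C) {u v : V} (h : (O i : Sym2 V) = s(u, v)) :
    (spanningSubgraph O (C.erase i)).Reachable u v := by
  obtain ⟨x, p, hp, hpC⟩ := hC
  have hq : ∀ e ∈ p.edges, e ∈ (spanningSubgraph O C).edgeSet := by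
    intro e he
    obtain ⟨j, hj⟩ := O.surjective ⟨e, p.edges_subset_edgeSet he⟩
    have hj' : (O j : Sym2 V) = e := by rw [hj]
    induction e with
    | h a b => exact adj_iff.2 ⟨j, (hpC j).2 (hj' ▸ he), hj'⟩
  have := (SimpleGraph.adj_and_reachable_delete_edges_iff_exists_cycle (v := u) (w := v)).2
    ⟨x, p.transfer _ hq, hp.transfer hq, by
      rw [SimpleGraph.Walk.edges_transfer, ← h]; exact (hpC i).1 hi⟩
  refine this.2.mono fun a b hab => ?_
  rw [SimpleGraph.deleteEdges_adj] at hab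
  obtain ⟨j, hj, hj'⟩ := adj_iff.1 hab.1
  refine adj_iff.2 ⟨j, Finset.mem_erase.2 ⟨fun hji => hab.2 ?_, hj⟩, hj'⟩
  rw [Set.mem_singleton_iff, ← hj', hji, h]

/-- Containing no broken circuit, without reference to circuits: no edge has its ends joined by
larger edges of `S`. -/
theorem mem_nbc_iff {S : Finset (Fin n)} : S ∈ NBC O ↔ ∀ (i : Fin n) (u v : V),
    (O i : Sym2 V) = s(u, v) → ¬ (spanningSubgraph O (S.filter (i < ·))).Reachable u v := by
  constructor
  · intro hS i u v h hr
    obtain ⟨C, hC, hiC, hCS⟩ := exists_isCycleEdgeSet_of_reachable h (by simp) hr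
    refine hS _ ⟨C, i, hC, ⟨hiC, fun j hj => ?_⟩, rfl⟩ fun j hj => ?_
    · rcases Finset.mem_insert.1 (hCS hj) with rfl | hj
      · exact le_rfl
      · exact (Finset.mem_filter.1 hj).2.le
    · obtain ⟨hji, hj⟩ := Finset.mem_erase.1 hj
      exact (Finset.mem_filter.1 ((Finset.mem_insert.1 (hCS hj)).resolve_left hji)).1
  · rintro hS B ⟨C, i, hC, hi, rfl⟩ hB
    obtain ⟨u, v, h⟩ := exists_ends O i
    refine hS i u v h (reachable_mono (fun j hj => ?_) (hC.reachable_erase hi.1 h))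
    exact Finset.mem_filter.2 ⟨hB hj, lt_of_le_of_ne (hi.2 (Finset.mem_of_mem_erase hj))
      (Finset.ne_of_mem_erase hj).symm⟩

theorem empty_mem_nbc : (∅ : Finset (Fin n)) ∈ NBC O := by
  refine mem_nbc_iff.2 fun i u v h hr => ?_
  have : spanningSubgraph O (Finset.filter (i < ·) ∅) = ⊥ := by
    ext a b; simp [adj_iff]
  rw [this, SimpleGraph.reachable_bot] at hr
  exact ends_ne h hr

/-- An NBC set is a forest. -/
theorem not_reachable_erase_of_mem_nbc {S : Finset (Fin n)} (hS : S ∈ NBC O) {i : Fin n}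
    (hi : i ∈ S) {u v : V} (h : (O i : Sym2 V) = s(u, v)) :
    ¬ (spanningSubgraph O (S.erase i)).Reachable u v := by
  intro hr
  obtain ⟨C, hC, hiC, hCS⟩ := exists_isCycleEdgeSet_of_reachable h (by simp) hr
  rw [Finset.insert_erase hi] at hCS
  exact hS _ ⟨C, C.min' ⟨i, hiC⟩, hC, C.isLeast_min' _, rfl⟩ ((Finset.erase_subset _ _).trans hCS)

theorem isTree_iff {T : Finset (Fin n)} : (spanningSubgraph O T).IsTree ↔
    (spanningSubgraph O T).Connected ∧ ∀ i ∈ T, ∀ u v, (O i : Sym2 V) = s(u, v) →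
      ¬ (spanningSubgraph O (T.erase i)).Reachable u v := by
  have key : ∀ i u v, (O i : Sym2 V) = s(u, v) → (spanningSubgraph O T).deleteEdges {s(u, v)} =
      spanningSubgraph O (T.erase i) := by
    intro i u v h
    ext a b
    simp only [SimpleGraph.deleteEdges_adj, adj_iff, Set.mem_singleton_iff, Finset.mem_erase]
    constructor
    · rintro ⟨⟨j, hj, hj'⟩, hne⟩
      exact ⟨j, ⟨fun hji => hne (by rw [← hj', hji, h]), hj⟩, hj'⟩
    · rintro ⟨j, ⟨hji, hj⟩, hj'⟩
      exact ⟨⟨j, hj, hj'⟩, fun hc => hji (O.injective (Subtype.ext (by rw [hj', hc, h])))⟩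
  constructor
  · intro hT
    refine ⟨hT.connected, fun i hi u v h => ?_⟩
    have := SimpleGraph.isAcyclic_iff_forall_isBridge.1 hT.isAcyclic
      (e := s(u, v)) (adj_iff.2 ⟨i, hi, h⟩)
    rwa [SimpleGraph.isBridge_iff, key i u v h] at this
  · rintro ⟨h1, h2⟩
    refine ⟨h1, SimpleGraph.isAcyclic_iff_forall_isBridge.2 fun e he => ?_⟩
    induction e with
    | h u v =>
      obtain ⟨i, hi, h⟩ := adj_iff.1 he
      rw [SimpleGraph.isBridge_iff, key i u v h]
      exact h2 i hi u v h

theorem card_of_isTree [Finite V] {T : Finset (Fin n)} (hT : (spanningSubgraph O T).IsTree) :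
    T.card + 1 = Nat.card V := by
  rw [← (SimpleGraph.isTree_iff_connected_and_card.1 hT).2]
  congr 1
  have : (spanningSubgraph O T).edgeSet = (fun i => (O i : Sym2 V)) '' (T : Set (Fin n)) := by
    ext e
    induction e with
    | h u v => rw [SimpleGraph.mem_edgeSet, adj_iff]; simp
  rw [this, Nat.card_image_of_injective fun i j h => O.injective (Subtype.ext h)]
  simp

theorem connected_of_reachable_ends (hG : G.Connected) {S : Finset (Fin n)}
    (h : ∀ i u v, (O i : Sym2 V) = s(u, v) → (spanningSubgraph O S).Reachable u v) :
    (spanningSubgraph O S).Connected := by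
  have := hG.nonempty
  refine ⟨fun a b => ?_⟩
  obtain ⟨p⟩ := hG.preconnected a b
  induction p with
  | nil => exact .refl _
  | cons hab p ih =>
    obtain ⟨i, hi⟩ := O.surjective ⟨s(_, _), hab⟩
    exact (h i _ _ (by rw [hi])).trans ih

theorem connected_of_reachable_of_subset {S S' : Finset (Fin n)} {i : Fin n} {u v : V}
    (h : (O i : Sym2 V) = s(u, v)) (hS : (spanningSubgraph O (insert i S)).Connected)
    (hSS' : S ⊆ S') (huv : (spanningSubgraph O S').Reachable u v) :
    (spanningSubgraph O S').Connected := by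
  have := hS.nonempty
  refine ⟨fun x y => ?_⟩
  rcases reachable_insert h (hS.preconnected x y) with h | ⟨h1, h2⟩ | ⟨h1, h2⟩
  · exact reachable_mono hSS' h
  · exact (reachable_mono hSS' h1).symm.trans (huv.trans (reachable_mono hSS' h2))
  · exact (reachable_mono hSS' h1).symm.trans (huv.symm.trans (reachable_mono hSS' h2))

/-- Joining two components of an NBC set by the least edge that joins different components
creates no broken circuit: a circuit through the new edge has a second edge between different
components, which is larger. -/
theorem insert_mem_nbc {S : Finset (Fin n)} (hS : S ∈ NBC O) {e : Fin n} {u v : V}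
    (h : (O e : Sym2 V) = s(u, v)) (hne : ¬ (spanningSubgraph O S).Reachable u v)
    (hmin : ∀ j < e, ∀ a b, (O j : Sym2 V) = s(a, b) → (spanningSubgraph O S).Reachable a b) :
    insert e S ∈ NBC O := by
  refine mem_nbc_iff.2 fun i a b hab hr => ?_
  have hS' := mem_nbc_iff.1 hS i a b hab
  have hsub : S.filter (i < ·) ⊆ S := Finset.filter_subset _ _
  rw [Finset.filter_insert] at hr
  split_ifs at hr with hie
  · rcases reachable_insert h hr with hr | ⟨h1, h2⟩ | ⟨h1, h2⟩
    · exact hS' hr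
    · exact hne ((reachable_mono hsub h1).trans
        ((hmin i hie a b hab).trans (reachable_mono hsub h2).symm))
    · exact hne ((reachable_mono hsub h2).trans
        ((hmin i hie a b hab).symm.trans (reachable_mono hsub h1).symm))
  · exact hS' hr

/-! ### The facets of the NBC complex -/

theorem isNBCTree_of_isFacet (hG : G.Connected) {T : Finset (Fin n)}
    (hT : Shelling.IsFacet (NBC O) T) : IsNBCTree O T := by
  refine ⟨isTree_iff.2 ⟨connected_of_reachable_ends hG ?_, fun i hi u v h =>
    not_reachable_erase_of_mem_nbc hT.1 hi h⟩, hT.1⟩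
  intro i
  induction i using WellFoundedLT.induction with
  | ind i ih =>
    intro u v h
    by_contra hne
    have h1 := hT.2 (insert_mem_nbc hT.1 h hne ih) (Finset.subset_insert _ _)
    exact hne (reachable_ends (h1 (Finset.mem_insert_self _ _)) h)

theorem IsNBCTree.isFacet {T : Finset (Fin n)} (hT : IsNBCTree O T) :
    Shelling.IsFacet (NBC O) T := by
  refine ⟨hT.2, fun S hS hTS i hi => ?_⟩
  by_contra hiT
  obtain ⟨u, v, h⟩ := exists_ends O i
  refine not_reachable_erase_of_mem_nbc hS hi h (reachable_mono ?_ (hT.1.connected u v))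
  exact fun j hj => Finset.mem_erase.2 ⟨fun hji => hiT (hji ▸ hj), hTS hj⟩

theorem isFacet_nbc_iff (hG : G.Connected) {T : Finset (Fin n)} :
    Shelling.IsFacet (NBC O) T ↔ IsNBCTree O T :=
  ⟨isNBCTree_of_isFacet hG, IsNBCTree.isFacet⟩

theorem exists_isNBCTree (hG : G.Connected) {S : Finset (Fin n)} (hS : S ∈ NBC O) :
    ∃ T, S ⊆ T ∧ IsNBCTree O T := by
  obtain ⟨T, hST, hT⟩ := Finite.exists_le_maximal (p := (· ∈ NBC O)) hS
  exact ⟨T, hST, isNBCTree_of_isFacet hG hT⟩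

/-! ### The lexicographic order -/

/-- Equal length matters here: a proper prefix is smaller even if it is the other list that has
the least element of the difference. -/
theorem list_lt_of_mem_of_notMem {α : Type*} [LinearOrder α] {m : α} :
    ∀ {l₁ l₂ : List α}, l₁.Pairwise (· < ·) → l₂.Pairwise (· < ·) → l₁.length = l₂.length →
      m ∈ l₁ → m ∉ l₂ → (∀ j < m, j ∈ l₁ ↔ j ∈ l₂) → l₁ < l₂
  | [], _, _, _, _, hm, _, _ => by simp at hm
  | _ :: _, [], _, _, hl, _, _, _ => by simp at hl
  | a :: l₁, b :: l₂, h₁, h₂, hl, hm, hm', h => by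
    rw [List.pairwise_cons] at h₁ h₂
    rw [List.cons_lt_cons_iff]
    rcases lt_trichotomy a b with hab | rfl | hba
    · exact Or.inl hab
    · refine Or.inr ⟨rfl, list_lt_of_mem_of_notMem (m := m) h₁.2 h₂.2 (by simpa using hl) ?_ ?_ ?_⟩
      · rcases List.mem_cons.1 hm with rfl | hm
        · simp at hm'
        · exact hm
      · exact fun hh => hm' (List.mem_cons_of_mem _ hh)
      · intro j hj
        have := h j hj
        simp only [List.mem_cons] at this
        constructor
        · intro hj1
          exact (this.1 (Or.inr hj1)).resolve_left (h₁.1 j hj1).ne'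
        · intro hj1
          exact (this.2 (Or.inr hj1)).resolve_left (h₂.1 j hj1).ne'
    · exfalso
      have ham : a ≤ m := by
        rcases List.mem_cons.1 hm with rfl | hm
        · exact le_rfl
        · exact (h₁.1 m hm).le
      rcases List.mem_cons.1 ((h b (hba.trans_le ham)).2 List.mem_cons_self) with hh | hh
      · exact hba.ne hh
      · exact (h₁.1 b hh).not_gt hba

theorem lexLT_of_mem_of_notMem {A B : Finset (Fin n)} (hc : A.card = B.card) {m : Fin n}
    (hA : m ∈ A) (hB : m ∉ B) (h : ∀ j < m, j ∈ A ↔ j ∈ B) : LexLT A B :=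
  list_lt_of_mem_of_notMem (m := m) (Finset.sortedLT_sort A).pairwise
    (Finset.sortedLT_sort B).pairwise (by simpa using hc) (by simpa) (by simpa) (by simpa)

theorem LexLT.irrefl (A : Finset (Fin n)) : ¬ LexLT A A := lt_irrefl (A.sort (· ≤ ·))

theorem LexLT.trans {A B C : Finset (Fin n)} (h : LexLT A B) (h' : LexLT B C) : LexLT A C :=
  lt_trans (a := A.sort (· ≤ ·)) h h'

theorem sort_injective : Function.Injective fun A : Finset (Fin n) => A.sort (· ≤ ·) := by
  intro A B h
  have h' : A.sort (· ≤ ·) = B.sort (· ≤ ·) := h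
  rw [← A.sort_toFinset (· ≤ ·), h', B.sort_toFinset]

theorem LexLT.total {A B : Finset (Fin n)} (h : A ≠ B) : LexLT A B ∨ LexLT B A :=
  lt_or_gt_of_ne fun h' => h (sort_injective h')

/-- For sets of one size, `A` precedes `B` only if the least element of the symmetric
difference lies in `A`. -/
theorem LexLT.exists_mem {A B : Finset (Fin n)} (hc : A.card = B.card) (h : LexLT A B) :
    ∃ m ∈ A, m ∉ B ∧ ∀ j < m, j ∈ A ↔ j ∈ B := by
  classical
  have hne : (symmDiff A B).Nonempty := by
    rw [Finset.nonempty_iff_ne_empty]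
    intro h0
    rw [← Finset.bot_eq_empty, symmDiff_eq_bot] at h0
    exact LexLT.irrefl A (h0 ▸ h)
  have hm := Finset.isLeast_min' (symmDiff A B) hne
  generalize (symmDiff A B).min' hne = m at hm
  have hagree : ∀ j < m, j ∈ A ↔ j ∈ B := by
    intro j hj
    by_contra hjn
    refine hj.not_ge (hm.2 ?_)
    rw [Finset.mem_coe, Finset.mem_symmDiff]
    tauto
  rcases Finset.mem_symmDiff.1 hm.1 with ⟨h1, h2⟩ | ⟨h1, h2⟩
  · exact ⟨m, h1, h2, hagree⟩
  · exact absurd (h.trans (lexLT_of_mem_of_notMem hc.symm h1 h2 fun j hj => (hagree j hj).symm))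
      (LexLT.irrefl _)

/-! ### Inactive edges and the shelling -/

theorem mem_inactive {T : Finset (Fin n)} {i : Fin n} :
    i ∈ inactive O T ↔ i ∈ T ∧ ¬ IsLeast (cut O T i) i := by
  classical
  simp [inactive]

theorem IsNBCTree.mem_inactive_iff {T : Finset (Fin n)} (hT : IsNBCTree O T) {i : Fin n}
    (hi : i ∈ T) : i ∈ inactive O T ↔ ∃ j ∈ cut O T i, j < i := by
  have hii : i ∈ cut O T i := by
    simpa [cut, Finset.insert_erase hi] using hT.1.connected
  simp [mem_inactive, hi, IsLeast, hii, lowerBounds]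

/-- Exchanging an inactive edge for the least edge of its cut gives an earlier NBC tree. -/
theorem IsNBCTree.exists_lexLT [Finite V] {T : Finset (Fin n)} (hT : IsNBCTree O T)
    {i : Fin n} (hi : i ∈ inactive O T) : ∃ T', IsNBCTree O T' ∧ LexLT T' T ∧ T.erase i ⊆ T' := by
  classical
  have hiT := inactive_subset T hi
  obtain ⟨j, hj, hji⟩ := (hT.mem_inactive_iff hiT).1 hi
  obtain ⟨m, hm1, hm2⟩ := Set.exists_min_image (cut O T i) id (Set.toFinite _) ⟨j, hj⟩
  have hm : IsLeast (cut O T i) m := ⟨hm1, hm2⟩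
  have hmi : m < i := (hm.2 hj).trans_lt hji
  obtain ⟨u, v, huv⟩ := exists_ends O i
  have hcut := not_reachable_erase_of_mem_nbc hT.2 hiT huv
  have hmc : (spanningSubgraph O (insert m (T.erase i))).Connected := hm.1
  obtain ⟨a, b, hab⟩ := exists_ends O m
  have hne : ¬ (spanningSubgraph O (T.erase i)).Reachable a b := by
    intro hr
    rcases reachable_insert hab (hmc.preconnected u v) with h | ⟨h1, h2⟩ | ⟨h1, h2⟩
    · exact hcut h
    · exact hcut (h1.symm.trans (hr.trans h2))
    · exact hcut (h1.symm.trans (hr.symm.trans h2))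
  have hmT : m ∉ T.erase i := fun h => hne (reachable_ends h hab)
  have hE : T.erase i ∈ NBC O := nbc_mono (Finset.erase_subset _ _) hT.2
  -- Every pair of vertices is joined in `T - i` or through `i`, so an edge between the two
  -- components of `T - i` lies in the cut.
  have hmin : ∀ k < m, ∀ c d, (O k : Sym2 V) = s(c, d) →
      (spanningSubgraph O (T.erase i)).Reachable c d := by
    intro k hk c d hcd
    by_contra hncd
    refine hk.not_ge (hm.2 ?_)
    have hcon : (spanningSubgraph O (insert i (T.erase i))).Connected := by
      rw [Finset.insert_erase hiT]
      exact hT.1.connected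
    have hsub : T.erase i ⊆ insert k (T.erase i) := Finset.subset_insert _ _
    have hk' := reachable_ends (O := O) (Finset.mem_insert_self k (T.erase i)) hcd
    refine connected_of_reachable_of_subset huv hcon hsub ?_
    rcases reachable_insert huv (hcon.preconnected c d) with h | ⟨h1, h2⟩ | ⟨h1, h2⟩
    · exact absurd h hncd
    · exact (reachable_mono hsub h1).trans (hk'.trans (reachable_mono hsub h2).symm)
    · exact (reachable_mono hsub h2).trans (hk'.symm.trans (reachable_mono hsub h1).symm)
  have hnbc := insert_mem_nbc hE hab hne hmin
  have hT' : IsNBCTree O (insert m (T.erase i)) :=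
    ⟨isTree_iff.2 ⟨hmc, fun k hk c d hcd => not_reachable_erase_of_mem_nbc hnbc hk hcd⟩, hnbc⟩
  refine ⟨_, hT', lexLT_of_mem_of_notMem (m := m) ?_ (Finset.mem_insert_self _ _) ?_ ?_,
    Finset.subset_insert _ _⟩
  · have := card_of_isTree hT.1
    have := card_of_isTree hT'.1
    omega
  · exact fun h => hmT (Finset.mem_erase.2 ⟨hmi.ne, h⟩)
  · intro k hk
    simp [hk.ne, (hk.trans hmi).ne]

/-- The exchange step behind the shelling. If `m` is the least edge in which `T'` and `T` differ,
the circuit that `m` closes with `T` has an edge `x ∉ T'`; then `m < x`, so `x` is inactive. -/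
theorem IsNBCTree.exists_mem_inactive [Finite V] {T T' : Finset (Fin n)} (hT : IsNBCTree O T)
    (hT' : IsNBCTree O T') (h : LexLT T' T) : ∃ i ∈ inactive O T, i ∉ T' := by
  classical
  have hcard := card_of_isTree hT.1
  have hcard' := card_of_isTree hT'.1
  obtain ⟨m, hm', hm, hagree⟩ := h.exists_mem (by omega)
  obtain ⟨u, v, huv⟩ := exists_ends O m
  have h0 : ¬ (spanningSubgraph O (T ∩ T')).Reachable u v := fun hr =>
    not_reachable_erase_of_mem_nbc hT'.2 hm' huv (reachable_mono (fun j hj => by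
      rw [Finset.mem_inter] at hj
      exact Finset.mem_erase.2 ⟨fun hjm => hm (hjm ▸ hj.1), hj.2⟩) hr)
  -- Any edge of `T` outside a maximal `S ⊇ T ∩ T'` not joining the ends of `m` lies on the circuit.
  obtain ⟨S, hS0, hS⟩ := Finite.exists_le_maximal
    (p := fun S : Finset (Fin n) => S ⊆ T ∧ ¬ (spanningSubgraph O S).Reachable u v)
    ⟨Finset.inter_subset_left, h0⟩
  obtain ⟨x, hxT, hxS⟩ : ∃ x ∈ T, x ∉ S := by
    by_contra! hall
    exact hS.1.2 (reachable_mono hall (hT.1.connected u v))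
  have hxT' : x ∉ T' := fun hx => hxS (hS0 (Finset.mem_inter.2 ⟨hxT, hx⟩))
  have hmx : m < x := by
    rcases lt_trichotomy m x with h | h | h
    · exact h
    · exact absurd (h ▸ hm') hxT'
    · exact absurd ((hagree x h).2 hxT) hxT'
  refine ⟨x, (hT.mem_inactive_iff hxT).2 ⟨m, ?_, hmx⟩, hxT'⟩
  obtain ⟨a, b, hab⟩ := exists_ends O x
  have hxr : (spanningSubgraph O (insert x S)).Reachable u v := by
    by_contra hn
    exact hxS (hS.2 ⟨Finset.insert_subset hxT hS.1.1, hn⟩ (Finset.subset_insert _ _)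
      (Finset.mem_insert_self _ _))
  have hsub : S ⊆ insert m (T.erase x) := fun j hj => Finset.mem_insert_of_mem
    (Finset.mem_erase.2 ⟨fun hjx => hxS (hjx ▸ hj), hS.1.1 hj⟩)
  have hmr := reachable_ends (O := O) (Finset.mem_insert_self m (T.erase x)) huv
  have habr : (spanningSubgraph O (insert m (T.erase x))).Reachable a b := by
    rcases reachable_insert hab hxr with h | ⟨h1, h2⟩ | ⟨h1, h2⟩
    · exact absurd h hS.1.2
    · exact (reachable_mono hsub h1).trans (hmr.trans (reachable_mono hsub h2).symm)
    · exact (reachable_mono hsub h2).trans (hmr.symm.trans (reachable_mono hsub h1).symm)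
  refine connected_of_reachable_of_subset hab ?_ (Finset.subset_insert _ _) habr
  rw [Finset.insert_erase hxT]
  exact hT.1.connected

theorem isShelling_nbc [Finite V] (hG : G.Connected) : Shelling.IsShelling (NBC O) LexLT := by
  classical
  refine ⟨⟨∅, empty_mem_nbc⟩, fun S S' h h' => nbc_mono h h', fun F F' hF hF' => ?_,
    fun F _ => LexLT.irrefl F, fun _ _ _ _ _ _ h h' => h.trans h', fun F F' _ _ h => LexLT.total h,
    fun Fi Fj hi hj hij => ?_⟩
  · have := card_of_isTree (isNBCTree_of_isFacet hG hF).1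
    have := card_of_isTree (isNBCTree_of_isFacet hG hF').1
    omega
  · have hj' := isNBCTree_of_isFacet hG hj
    obtain ⟨x, hx, hxi⟩ := hj'.exists_mem_inactive (isNBCTree_of_isFacet hG hi) hij
    obtain ⟨Fk, hk, hkj, hsub⟩ := hj'.exists_lexLT hx
    have hxk : x ∉ Fk := fun hxk => by
      have : Fj ⊆ Fk := by
        rw [← Finset.insert_erase (inactive_subset _ hx)]
        exact Finset.insert_subset hxk hsub
      exact LexLT.irrefl Fj ((this.antisymm (hj.2 hk.2 this)) ▸ hkj)
    have hkx : Fk ∩ Fj = Fj.erase x := by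
      ext y
      simp only [Finset.mem_inter, Finset.mem_erase]
      exact ⟨fun h => ⟨fun hy => hxk (hy ▸ h.1), h.2⟩,
        fun h => ⟨hsub (Finset.mem_erase.2 h), h.2⟩⟩
    refine ⟨Fk, hk.isFacet, hkj, x, inactive_subset _ hx, ?_, hkx⟩
    rw [hkx]
    intro y hy
    rw [Finset.mem_inter] at hy
    exact Finset.mem_erase.2 ⟨fun h => hxi (h ▸ hy.1), hy.2⟩

theorem IsNBCTree.restriction_eq [Finite V] (hG : G.Connected) {T : Finset (Fin n)}
    (hT : IsNBCTree O T) : Shelling.restriction (NBC O) LexLT T = inactive O T := by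
  ext x
  constructor
  · rintro ⟨-, F, hF, hlt, hsub⟩
    obtain ⟨y, hy, hyF⟩ := hT.exists_mem_inactive (isNBCTree_of_isFacet hG hF) hlt
    rcases eq_or_ne y x with rfl | hyx
    · exact hy
    · exact absurd (hsub (Finset.mem_erase.2 ⟨hyx, inactive_subset _ hy⟩)) hyF
  · intro hx
    obtain ⟨F, hF, hlt, hsub⟩ := hT.exists_lexLT hx
    exact ⟨inactive_subset _ hx, F, hF.isFacet, hlt, hsub⟩

/-- The tree of the interval containing a set is monotone in the set. -/
theorem not_lexLT_of_inactive_subset [Finite V] {S S' T T' : Finset (Fin n)} (hT : IsNBCTree O T)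
    (hT' : IsNBCTree O T') (hS : inactive O T ⊆ S) (hSS' : S ⊆ S') (hS' : S' ⊆ T') :
    ¬ LexLT T' T := by
  intro h
  obtain ⟨x, hx, hxT'⟩ := hT.exists_mem_inactive hT' h
  exact hxT' (hS' (hSS' (hS hx)))

theorem existsUnique_interval [Finite V] (hG : G.Connected) {S : Finset (Fin n)} (hS : S ∈ NBC O) :
    ∃! T, IsNBCTree O T ∧ S ∈ Set.Icc (inactive O T) T := by
  obtain ⟨T₀, hT₀⟩ := exists_isNBCTree hG hS
  obtain ⟨T, ⟨hST, hT⟩, hmin⟩ := Set.exists_min_image {T | S ⊆ T ∧ IsNBCTree O T}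
    (fun T => T.sort (· ≤ ·)) (Set.toFinite _) ⟨T₀, hT₀⟩
  refine ⟨T, ⟨hT, fun x hx => ?_, hST⟩, fun T' ⟨hT', h1, h2⟩ => ?_⟩
  · by_contra hxS
    obtain ⟨F, hF, hlt, hsub⟩ := hT.exists_lexLT hx
    refine (hmin F ⟨fun y hy => hsub (Finset.mem_erase.2 ⟨fun h => hxS (h ▸ hy), hST hy⟩), hF⟩).not_gt
      hlt
  · by_contra hne
    rcases LexLT.total hne with h | h
    · exact (hmin T' ⟨h2, hT'⟩).not_gt h
    · exact not_lexLT_of_inactive_subset hT' hT h1 subset_rfl hST h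

/-! ### Rooted spanning trees -/

/-- The branch of a rooted spanning tree beyond its edge `i`: the vertices cut off from the root
`r` when `i` is removed. -/
def branch (O : Fin n ≃ G.edgeSet) (r : V) (T : Finset (Fin n)) (i : Fin n) : Set V :=
  {w | ¬ (spanningSubgraph O (T.erase i)).Reachable r w}

open Classical in
/-- The end of the tree edge `i` that is further from the root `r`. It is characterized by
`exists_parent` if `T` is a spanning tree containing `i`; otherwise it may be the junk value `r`. -/
noncomputable def child (O : Fin n ≃ G.edgeSet) (r : V) (T : Finset (Fin n)) (i : Fin n) : V :=
  if h : ∃ v ∈ branch O r T i, v ∈ (O i : Sym2 V) then h.choose else r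

variable {r : V} {T S : Finset (Fin n)} {i j : Fin n}

theorem root_notMem_branch : r ∉ branch O r T i := fun h => h (.refl r)

theorem mem_branch_iff_of_reachable (hST : S ⊆ T) (hi : i ∉ S) {a b : V}
    (h : (spanningSubgraph O S).Reachable a b) : a ∈ branch O r T i ↔ b ∈ branch O r T i := by
  have h' : (spanningSubgraph O (T.erase i)).Reachable a b :=
    reachable_mono (fun j hj => Finset.mem_erase.2 ⟨ne_of_mem_of_not_mem hj hi, hST hj⟩) h
  exact not_congr ⟨fun hr => hr.trans h', fun hr => hr.trans h'.symm⟩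

theorem exists_parent (hT : (spanningSubgraph O T).IsTree) (r : V) (hi : i ∈ T) :
    ∃ u, (O i : Sym2 V) = s(u, child O r T i) ∧ u ∉ branch O r T i ∧
      child O r T i ∈ branch O r T i := by
  obtain ⟨a, b, hab⟩ := exists_ends O i
  have hcut := (isTree_iff.1 hT).2 i hi a b hab
  have hex : ∃ v ∈ branch O r T i, v ∈ (O i : Sym2 V) := by
    by_contra! h
    have ha := not_not.1 fun hn => h a hn (by simp [hab])
    have hb := not_not.1 fun hn => h b hn (by simp [hab])
    exact hcut (ha.symm.trans hb)
  have hc : child O r T i = hex.choose := dif_pos hex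
  obtain ⟨h1, u, h2⟩ := hex.choose_spec
  rw [← hc] at h1 h2
  refine ⟨u, by rw [h2, Sym2.eq_swap], fun hu => ?_, h1⟩
  have hcon := hT.connected.preconnected r u
  rw [← Finset.insert_erase hi] at hcon
  rcases reachable_insert h2 hcon with h | ⟨h3, -⟩ | ⟨h3, -⟩
  · exact hu h
  · exact h1 h3.symm
  · exact hu h3.symm

/-- A component of a subforest of a rooted tree has only one highest vertex. -/
theorem not_reachable_child (hT : (spanningSubgraph O T).IsTree) (hST : S ⊆ T) (hi : i ∈ T)
    (hj : j ∈ T) (hij : i ≠ j) (hiS : i ∉ S) (hjS : j ∉ S) :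
    ¬ (spanningSubgraph O S).Reachable (child O r T i) (child O r T j) := by
  intro h
  obtain ⟨u, hu, -, hi1⟩ := exists_parent hT r hi
  obtain ⟨v, hv, hv1, hj1⟩ := exists_parent hT r hj
  have hij' : child O r T i ∈ branch O r T j := (mem_branch_iff_of_reachable hST hjS h).2 hj1
  have hji' : child O r T j ∈ branch O r T i := (mem_branch_iff_of_reachable hST hiS h).1 hi1
  have hv2 : v ∈ branch O r T i := (mem_branch_iff_of_reachable (Finset.erase_subset i T) (by simp)
    (reachable_ends (Finset.mem_erase.2 ⟨hij.symm, hj⟩) hv)).2 hji'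
  have hv3 := not_not.1 hv1
  rw [← Finset.insert_erase (Finset.mem_erase.2 ⟨hij, hi⟩)] at hv3
  have hle : (T.erase j).erase i ⊆ T.erase i := Finset.erase_subset_erase _ (Finset.erase_subset _ _)
  rcases reachable_insert hu hv3 with h | ⟨-, h⟩ | ⟨h, -⟩
  · exact hv2 (reachable_mono hle h)
  · exact hij' ((not_not.1 hv1).trans (reachable_mono (Finset.erase_subset _ _) h).symm)
  · exact hi1 (reachable_mono hle h.symm)

theorem not_reachable_child_root (hT : (spanningSubgraph O T).IsTree) (hST : S ⊆ T) (hi : i ∈ T)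
    (hiS : i ∉ S) : ¬ (spanningSubgraph O S).Reachable (child O r T i) r := by
  obtain ⟨u, -, -, hi1⟩ := exists_parent hT r hi
  exact fun h => root_notMem_branch ((mem_branch_iff_of_reachable hST hiS h).1 hi1)

/-- The highest vertex of a component is the root or the lower end of a missing tree edge. -/
theorem exists_top (hT : (spanningSubgraph O T).IsTree) (hST : S ⊆ T) (w : V) :
    (spanningSubgraph O S).Reachable r w ∨
      ∃ i ∈ T, i ∉ S ∧ (spanningSubgraph O S).Reachable (child O r T i) w := by
  suffices key : ∀ D : Finset (Fin n), ∀ w, (spanningSubgraph O (T \ D)).Reachable r w ∨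
      ∃ i ∈ T, i ∉ T \ D ∧ (spanningSubgraph O (T \ D)).Reachable (child O r T i) w by
    simpa [Finset.sdiff_sdiff_eq_self hST] using key (T \ S) w
  intro D
  induction D using Finset.induction_on with
  | empty => exact fun w => Or.inl (by simpa using hT.connected.preconnected r w)
  | insert e D _ ih =>
    intro w
    by_cases he : e ∈ T \ D
    · have hD : T \ D = insert e (T \ insert e D) := by
        rw [Finset.sdiff_insert, Finset.insert_erase he]
      have heT : e ∈ T := (Finset.mem_sdiff.1 he).1
      have heD : e ∉ T \ insert e D := by simp
      obtain ⟨u, hu, -, -⟩ := exists_parent hT r heT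
      rw [hD] at ih
      rcases ih w with h | ⟨i, hi, hiD, h⟩
      · rcases reachable_insert hu h with h | ⟨-, h2⟩ | ⟨h1, -⟩
        · exact Or.inl h
        · exact Or.inr ⟨e, heT, heD, h2⟩
        · exact absurd h1 (not_reachable_child_root hT Finset.sdiff_subset heT heD)
      · rw [Finset.mem_insert, not_or] at hiD
        rcases reachable_insert hu h with h | ⟨-, h2⟩ | ⟨h1, -⟩
        · exact Or.inr ⟨i, hi, hiD.2, h⟩
        · exact Or.inr ⟨e, heT, heD, h2⟩
        · exact absurd h1
            (not_reachable_child hT Finset.sdiff_subset heT hi (Ne.symm hiD.1) heD hiD.2)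
    · have hD : T \ insert e D = T \ D := by rw [Finset.sdiff_insert, Finset.erase_eq_of_notMem he]
      rw [hD]
      exact ih w

theorem branch_ssubset (hi : i ∈ T) (hij : i ≠ j) {u : V}
    (hu : (O i : Sym2 V) = s(u, child O r T i)) (hu1 : u ∉ branch O r T i)
    (hi1 : child O r T i ∈ branch O r T i) (hu2 : u ∈ branch O r T j) :
    branch O r T i ⊂ branch O r T j := by
  refine ⟨fun w hw hwj => ?_, fun h => hu1 (h hu2)⟩
  rw [← Finset.insert_erase (Finset.mem_erase.2 ⟨hij, hi⟩)] at hwj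
  have hle : (T.erase j).erase i ⊆ T.erase i := Finset.erase_subset_erase _ (Finset.erase_subset _ _)
  rcases reachable_insert hu hwj with h | ⟨h, -⟩ | ⟨h, -⟩
  · exact hw (reachable_mono hle h)
  · exact hu2 (reachable_mono (Finset.erase_subset _ _) h.symm)
  · exact hi1 (reachable_mono hle h.symm)

/-! ### Adding an edge at a component coloured `1` -/

theorem exists_state (S : Finset (Fin n)) (f : V → Color)
    (hf : ∀ a b, (spanningSubgraph O S).Reachable a b → f a = f b) :
    ∃ c : EnhancedState O, c.edges = S ∧ ∀ w, c.colorAt w = f w :=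
  ⟨⟨S, Quot.lift f hf⟩, rfl, fun _ => rfl⟩

variable {c d : EnhancedState O} {u v w : V}

theorem Color.ne_one_iff {a : Color} : a ≠ .one ↔ a = .x := by cases a <;> simp

theorem IsEdgeImage.colorAt_eq (h : IsEdgeImage c i d) (huv : (O i : Sym2 V) = s(u, v))
    (hv : c.colorAt v = .one) (hw : ¬ c.graph.Reachable v w) : d.colorAt w = c.colorAt w := by
  obtain ⟨h1, h2⟩ := h.2 u v huv
  by_cases huv' : c.graph.Reachable u v
  · exact h1 huv' w
  · obtain ⟨h3, h4⟩ := h2 huv'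
    by_cases huw : c.graph.Reachable u w
    · have hd : d.colorAt u = d.colorAt w := by
        refine d.colorAt_eq (reachable_mono ?_ huw)
        rw [h.1]
        exact Finset.subset_insert _ _
      rw [← hd, ← c.colorAt_eq huw]
      rw [hv] at h4
      cases hcu : c.colorAt u <;> simp_all [Color.mul]
    · exact h3 w huw hw

/-- The product with the colour `1` is never `0`. -/
theorem exists_isEdgeImage (huv : (O i : Sym2 V) = s(u, v)) (hv : c.colorAt v = .one) :
    ∃ d, IsEdgeImage c i d := by
  classical
  have hvx : ∀ {w}, c.graph.Reachable v w → c.colorAt w ≠ .x := fun hw => by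
    rw [← c.colorAt_eq hw, hv]; simp
  obtain ⟨d, hd, hdc⟩ := exists_state (O := O) (insert i c.edges)
    (fun w => if c.graph.Reachable v w then c.colorAt u else c.colorAt w) (by
      intro a b hab
      rcases reachable_insert huv hab with h | ⟨h1, h2⟩ | ⟨h1, h2⟩
      · have : c.graph.Reachable v a ↔ c.graph.Reachable v b :=
          ⟨fun h' => h'.trans h, fun h' => h'.trans h.symm⟩
        simp only [this, c.colorAt_eq h]
      · have h2' : c.graph.Reachable v b := h2
        simp only [h2', if_true, c.colorAt_eq h1, ite_self]
      · have h1' : c.graph.Reachable v a := h1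
        simp only [h1', if_true, c.colorAt_eq h2, ite_self])
  have huv' : d.graph.Reachable u v := reachable_ends (by rw [hd]; simp) huv
  have hmono : ∀ {a b}, c.graph.Reachable a b → d.graph.Reachable a b := fun h =>
    reachable_mono (by rw [hd]; exact Finset.subset_insert _ _) h
  refine ⟨d, isEdgeImage_iff.2 ⟨hd, fun w hw => ?_, fun w w' hw hw' hww => ?_, fun w hw => ?_⟩⟩
  · rw [hdc, if_neg fun h => hvx h hw, hw]
  · rw [EnhancedState.graph, hd] at hww
    rcases reachable_insert huv hww with h | ⟨-, h⟩ | ⟨h, -⟩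
    · exact h
    · exact absurd hw' (hvx h)
    · exact absurd hw (hvx h)
  · rw [hdc] at hw
    split_ifs at hw with h
    · exact ⟨u, (huv'.trans (hmono h)).symm, hw⟩
    · exact ⟨w, .refl _, hw⟩

/-- An edge joining different components can be removed with one new component coloured `1`, the
other one keeping the colour. -/
theorem exists_isEdgeImage_erase (huv : (O i : Sym2 V) = s(u, v)) (hi : i ∈ d.edges)
    (hne : ¬ (spanningSubgraph O (d.edges.erase i)).Reachable u v) :
    ∃ c, c.edges = d.edges.erase i ∧ IsEdgeImage c i d ∧ c.colorAt v = .one := by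
  classical
  obtain ⟨c, hc, hcd⟩ := exists_state (O := O) (d.edges.erase i)
    (fun w => if (spanningSubgraph O (d.edges.erase i)).Reachable v w then .one
      else d.colorAt w) (by
      intro a b h
      have : (spanningSubgraph O (d.edges.erase i)).Reachable v a ↔
          (spanningSubgraph O (d.edges.erase i)).Reachable v b :=
        ⟨fun h' => h'.trans h, fun h' => h'.trans h.symm⟩
      simp only [this, d.colorAt_eq (reachable_mono (Finset.erase_subset _ _) h)])
  have hE : d.edges = insert i c.edges := by rw [hc, Finset.insert_erase hi]
  rw [← hc] at hcd hne
  have hx : ∀ {w}, c.colorAt w = .x → ¬ c.graph.Reachable v w := fun hw h => by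
    rw [hcd, if_pos h] at hw; simp at hw
  refine ⟨c, hc, isEdgeImage_iff.2 ⟨hE, fun w hw => ?_, fun w w' hw hw' hww => ?_,
    fun w hw => ?_⟩, by rw [hcd, if_pos (.refl _)]⟩
  · rw [← hw, hcd, if_neg (hx hw)]
  · rw [EnhancedState.graph, hE] at hww
    rcases reachable_insert huv hww with h | ⟨-, h⟩ | ⟨h, -⟩
    · exact h
    · exact absurd h (hx hw')
    · exact absurd h (hx hw)
  · by_cases h : c.graph.Reachable v w
    · have hwu : d.graph.Reachable w u :=
        (reachable_mono (by rw [hE]; exact Finset.subset_insert _ _) h).symm.trans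
          (reachable_ends hi huv).symm
      refine ⟨u, hwu, ?_⟩
      rw [hcd, if_neg fun h' => hne h'.symm, ← d.colorAt_eq hwu, hw]
    · exact ⟨w, .refl _, by rw [hcd, if_neg h, hw]⟩

/-- A state can be recovered from the result of adding a given edge at a component
coloured `1`. -/
theorem IsEdgeImage.unique_left {c' : EnhancedState O} (h : IsEdgeImage c i d)
    (h' : IsEdgeImage c' i d) (hi : i ∉ c.edges) (hi' : i ∉ c'.edges)
    (huv : (O i : Sym2 V) = s(u, v)) (hv : c.colorAt v = .one) (hv' : c'.colorAt v = .one) :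
    c = c' := by
  have hE : c.edges = c'.edges := by
    rw [← Finset.erase_insert hi, ← Finset.erase_insert hi', ← h.1, ← h'.1]
  have hg : c.graph = c'.graph := by rw [EnhancedState.graph, hE]
  refine EnhancedState.ext' hE fun w => ?_
  by_cases hw : c.graph.Reachable v w
  · rw [← c.colorAt_eq hw, ← c'.colorAt_eq (hg ▸ hw), hv, hv']
  · rw [← h.colorAt_eq huv hv hw, h'.colorAt_eq huv hv' (hg ▸ hw)]

/-! ### Togglable edges and the weight of a state -/

/-- The edges of `T` outside `IN(T)` along which the state `c` can be changed: those that lie in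
`c`, and those whose lower component is coloured `1`. -/
def togglable (O : Fin n ≃ G.edgeSet) (r : V) (T : Finset (Fin n)) (c : EnhancedState O) :
    Set (Fin n) :=
  {i | i ∈ T ∧ i ∉ inactive O T ∧ (i ∈ c.edges ∨ c.colorAt (child O r T i) = .one)}

/-- The missing tree edges whose lower component is coloured `x`. These are the components
coloured `x` that do not contain the root. -/
noncomputable def xTops (O : Fin n ≃ G.edgeSet) (r : V) (T : Finset (Fin n)) (c : EnhancedState O) :
    Finset (Fin n) :=
  (T \ c.edges).filter fun i => c.colorAt (child O r T i) = .x

/-- The sum, over the components coloured `x`, of the number of vertices at or below the highest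
vertex of the component. -/
noncomputable def xWeight (O : Fin n ≃ G.edgeSet) (r : V) (T : Finset (Fin n))
    (c : EnhancedState O) : ℕ :=
  ∑ i ∈ xTops O r T c, (branch O r T i).ncard + if c.colorAt r = .x then Nat.card V else 0

theorem mem_xTops : j ∈ xTops O r T c ↔
    j ∈ T ∧ j ∉ c.edges ∧ c.colorAt (child O r T j) = .x := by
  simp [xTops, and_assoc]

section

variable (hT : (spanningSubgraph O T).IsTree) (h : IsEdgeImage c i d) (hi : i ∉ c.edges)
  (hdT : d.edges ⊆ T)

include h hdT in
theorem IsEdgeImage.mem_and_subset : i ∈ T ∧ c.edges ⊆ T := by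
  rw [h.1] at hdT
  exact ⟨hdT (Finset.mem_insert_self _ _), (Finset.subset_insert _ _).trans hdT⟩

include hT h hi hdT

theorem IsEdgeImage.colorAt_child (hone : c.colorAt (child O r T i) = .one) (hj : j ∈ T)
    (hjd : j ∉ d.edges) : d.colorAt (child O r T j) = c.colorAt (child O r T j) := by
  obtain ⟨hiT, hcT⟩ := h.mem_and_subset hdT
  obtain ⟨u, hu, -, -⟩ := exists_parent hT r hiT
  rw [h.1, Finset.mem_insert, not_or] at hjd
  exact h.colorAt_eq hu hone (not_reachable_child hT hcT hiT hj (Ne.symm hjd.1) hi hjd.2)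

theorem IsEdgeImage.togglable_eq (hone : c.colorAt (child O r T i) = .one) :
    togglable O r T d = togglable O r T c := by
  ext j
  refine and_congr_right fun hj => and_congr_right fun _ => ?_
  by_cases hjd : j ∈ d.edges
  · refine iff_of_true (Or.inl hjd) ?_
    rw [h.1, Finset.mem_insert] at hjd
    rcases hjd with rfl | hjd
    · exact Or.inr hone
    · exact Or.inl hjd
  · have hjc : j ∉ c.edges := fun hjc => hjd (by rw [h.1]; exact Finset.mem_insert_of_mem hjc)
    rw [h.colorAt_child hT hi hdT hone hj hjd]
    simp [hjd, hjc]

theorem IsEdgeImage.xWeight_eq (hone : c.colorAt (child O r T i) = .one) :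
    xWeight O r T d = xWeight O r T c := by
  obtain ⟨hiT, hcT⟩ := h.mem_and_subset hdT
  obtain ⟨u, hu, -, -⟩ := exists_parent hT r hiT
  have htops : xTops O r T d = xTops O r T c := by
    ext j
    rw [mem_xTops, mem_xTops]
    refine and_congr_right fun hj => ?_
    by_cases hjd : j ∈ d.edges
    · refine iff_of_false (fun h' => h'.1 hjd) fun h' => ?_
      rw [h.1, Finset.mem_insert] at hjd
      rcases hjd with rfl | hjd
      · rw [hone] at h'; simp at h'
      · exact h'.1 hjd
    · have hjc : j ∉ c.edges := fun hjc => hjd (by rw [h.1]; exact Finset.mem_insert_of_mem hjc)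
      rw [h.colorAt_child hT hi hdT hone hj hjd]
      simp [hjd, hjc]
  rw [xWeight, xWeight, htops,
    h.colorAt_eq hu hone (not_reachable_child_root hT hcT hiT hi)]

/-- If the lower component of the added edge is coloured `x`, the upper one is coloured `1`, and
the colour `x` moves up the tree. -/
theorem IsEdgeImage.xWeight_lt [Finite V] (hx : c.colorAt (child O r T i) = .x) :
    xWeight O r T c < xWeight O r T d := by
  obtain ⟨hiT, hcT⟩ := h.mem_and_subset hdT
  obtain ⟨u, hu, hu1, hi1⟩ := exists_parent hT r hiT
  have hnr : ¬ c.graph.Reachable u (child O r T i) := fun hr =>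
    hu1 ((mem_branch_iff_of_reachable hcT hi hr).2 hi1)
  have hmul := ((h.2 _ _ hu).2 hnr).2
  have hcu : c.colorAt u = .one ∧ d.colorAt u = .x := by
    rw [hx] at hmul
    cases hcu : c.colorAt u <;> cases hdu : d.colorAt u <;> simp_all [Color.mul]
  have hmono : ∀ {a b}, c.graph.Reachable a b → d.graph.Reachable a b := fun hr =>
    reachable_mono (by rw [h.1]; exact Finset.subset_insert _ _) hr
  have hTr := (isEdgeImage_iff.1 h).2
  have hiA : i ∈ xTops O r T c := mem_xTops.2 ⟨hiT, hi, hx⟩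
  have hsub : (xTops O r T c).erase i ⊆ xTops O r T d := by
    intro j hj
    rw [Finset.mem_erase, mem_xTops] at hj
    exact mem_xTops.2 ⟨hj.2.1, by rw [h.1, Finset.mem_insert]; tauto, hTr.1 _ hj.2.2.2⟩
  have hsum := Finset.add_sum_erase _ (fun j => (branch O r T j).ncard) hiA
  rw [xWeight, xWeight, ← hsum]
  rcases exists_top (r := r) hT hcT u with hr | ⟨j, hj, hjc, hr⟩
  · have hcr : c.colorAt r = .one := by rw [c.colorAt_eq hr, hcu.1]
    have hdr : d.colorAt r = .x := by rw [d.colorAt_eq (hmono hr), hcu.2]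
    have h1 := Finset.sum_le_sum_of_subset (f := fun j => (branch O r T j).ncard) hsub
    have h2 : (branch O r T i).ncard < Nat.card V := by
      rw [← Set.ncard_univ]
      exact Set.ncard_lt_ncard (Set.ssubset_univ_iff.2 fun hh =>
        root_notMem_branch (hh ▸ Set.mem_univ r)) (Set.toFinite _)
    simp only [hcr, hdr, if_true, reduceCtorEq, if_false]
    omega
  · have hji : i ≠ j := by
      rintro rfl
      exact hnr hr.symm
    obtain ⟨-, -, -, hj1⟩ := exists_parent hT r hj
    have hlt := Set.ncard_lt_ncard (branch_ssubset hiT hji hu hu1 hi1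
      ((mem_branch_iff_of_reachable hcT hjc hr).1 hj1)) (Set.toFinite _)
    have hjA : j ∉ (xTops O r T c).erase i := by
      rw [Finset.mem_erase, mem_xTops, c.colorAt_eq hr, hcu.1]
      simp
    have hsub' : insert j ((xTops O r T c).erase i) ⊆ xTops O r T d := by
      refine Finset.insert_subset (mem_xTops.2 ⟨hj, ?_, ?_⟩) hsub
      · rw [h.1, Finset.mem_insert]
        exact fun h' => h'.elim hji.symm hjc
      · rw [d.colorAt_eq (hmono hr), hcu.2]
    have h1 := Finset.sum_le_sum_of_subset (f := fun j => (branch O r T j).ncard) hsub'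
    rw [Finset.sum_insert hjA] at h1
    have h3 : (if c.colorAt r = .x then Nat.card V else 0) ≤
        if d.colorAt r = .x then Nat.card V else 0 := by
      by_cases hcr : c.colorAt r = .x
      · rw [if_pos hcr, if_pos (hTr.1 _ hcr)]
      · rw [if_neg hcr]; exact Nat.zero_le _
    omega

end

/-! ### The matching -/

/-- The NBC spanning tree `T` with `S ∈ [IN(T), T]`, for an NBC set `S` of a connected graph. -/
noncomputable def intervalTree (O : Fin n ≃ G.edgeSet) (S : Finset (Fin n)) : Finset (Fin n) :=
  Classical.epsilon fun T => IsNBCTree O T ∧ S ∈ Set.Icc (inactive O T) T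

theorem intervalTree_spec [Finite V] (hG : G.Connected) (hS : S ∈ NBC O) :
    IsNBCTree O (intervalTree O S) ∧ inactive O (intervalTree O S) ⊆ S ∧ S ⊆ intervalTree O S :=
  Classical.epsilon_spec (existsUnique_interval hG hS).exists

theorem IsNBCTree.intervalTree_eq [Finite V] (hG : G.Connected) (hT : IsNBCTree O T)
    (h : inactive O T ⊆ S) (h' : S ⊆ T) : intervalTree O S = T :=
  (existsUnique_interval hG (nbc_mono h' hT.2)).unique (intervalTree_spec hG (nbc_mono h' hT.2))
    ⟨hT, h, h'⟩

/-- The least edge along which a state can be changed is added, if it is missing. -/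
def toggleMatching [Finite V] (O : Fin n ≃ G.edgeSet) (r : V) :
    Set ((nbcComplex O).Ω × (nbcComplex O).Ω) :=
  {p | ∃ i, IsLeast (togglable O r (intervalTree O p.1.1.edges) p.1.1) i ∧ i ∉ p.1.1.edges ∧
    IsEdgeImage p.1.1 i p.2.1}

theorem incidence_of_isEdgeImage [Finite V] {c d : (nbcComplex O).Ω} (hi : i ∉ c.1.edges)
    (h : IsEdgeImage c.1 i d.1) : (nbcComplex O).incidence c d = edgeSign c.1.edges i := by
  classical
  have h0 : (nbcComplex O).incidence c d = differential O (Finsupp.single c.1 1) d.1 :=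
    nbcDifferential_single_apply c d
  rw [h0, differential_single, Finsupp.finsetSum_apply, Finset.sum_eq_single i]
  · simp [perEdge_apply, h]
  · intro j hj hji
    rw [Finsupp.smul_apply, perEdge_apply, if_neg, smul_zero]
    intro h'
    have := h'.1
    rw [h.1] at this
    have hj' : j ∈ insert i c.1.edges := by rw [this]; exact Finset.mem_insert_self _ _
    exact (Finset.mem_compl.1 hj) ((Finset.mem_insert.1 hj').resolve_left hji)
  · intro hn
    exact absurd (Finset.mem_compl.2 hi) hn

theorem isUnit_edgeSign (S : Finset (Fin n)) (i : Fin n) : IsUnit (edgeSign S i) :=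
  (isUnit_one.neg).pow _

theorem exists_isEdgeImage_of_arrow [Finite V] {c d : (nbcComplex O).Ω}
    (h : (nbcComplex O).Arrow c d) : ∃ i ∉ c.1.edges, IsEdgeImage c.1 i d.1 :=
  exists_of_differential_ne_zero fun h0 => h ((nbcDifferential_single_apply c d).trans h0)

section

variable [Finite V] (hG : G.Connected)

include hG

/-- What the two states of a pair have in common. -/
theorem toggleMatching_spec {p : (nbcComplex O).Ω × (nbcComplex O).Ω}
    (hp : p ∈ toggleMatching O r) : ∃ T i, IsNBCTree O T ∧ inactive O T ⊆ p.1.1.edges ∧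
      p.2.1.edges ⊆ T ∧ i ∈ T ∧ i ∉ p.1.1.edges ∧ IsEdgeImage p.1.1 i p.2.1 ∧
      p.1.1.colorAt (child O r T i) = .one ∧
      intervalTree O p.1.1.edges = T ∧ intervalTree O p.2.1.edges = T ∧
      togglable O r T p.2.1 = togglable O r T p.1.1 ∧ IsLeast (togglable O r T p.1.1) i := by
  obtain ⟨i, hi, hic, h⟩ := hp
  obtain ⟨hT, hT1, hT2⟩ := intervalTree_spec hG p.1.2
  generalize hTeq : intervalTree O p.1.1.edges = T at *
  have hone := hi.1.2.2.resolve_left hic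
  have hsub : p.2.1.edges ⊆ T := by
    rw [h.1]; exact Finset.insert_subset hi.1.1 hT2
  have hsub' : inactive O T ⊆ p.2.1.edges := by
    rw [h.1]; exact hT1.trans (Finset.subset_insert _ _)
  exact ⟨T, i, hT, hT1, hsub, hi.1.1, hic, h, hone, rfl, hT.intervalTree_eq hG hsub' hsub,
    h.togglable_eq hT.1 hic hsub hone, hi⟩

theorem isMatching_toggleMatching : (nbcComplex O).IsMatching (toggleMatching O r) := by
  constructor
  · rintro p ⟨i, -, hi, h⟩
    rw [BasedCochainComplex.Arrow, incidence_of_isEdgeImage hi h]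
    exact (isUnit_edgeSign _ _).ne_zero
  · intro p hp q hq hpq
    obtain ⟨T, i, hT, -, hpT, hiT, hi, h, hone, hp1, hp2, htog, hleast⟩ := toggleMatching_spec hG hp
    obtain ⟨T', i', -, -, -, -, hi', h', hone', hq1, hq2, htog', hleast'⟩ :=
      toggleMatching_spec hG hq
    have hip : i ∈ p.2.1.edges := by rw [h.1]; exact Finset.mem_insert_self _ _
    have hiq : i' ∈ q.2.1.edges := by rw [h'.1]; exact Finset.mem_insert_self _ _
    refine ⟨fun he => hpq ?_, fun he => ?_, fun he => ?_, fun he => hpq ?_⟩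
    · rw [he] at hp1 hleast h
      obtain rfl : T' = T := hq1.symm.trans hp1
      obtain rfl := hleast.unique hleast'
      exact Prod.ext he (Subtype.ext (h.unique h'))
    · rw [he] at hp1 hleast hi
      obtain rfl : T' = T := hq2.symm.trans hp1
      rw [htog'] at hleast
      exact hi (hleast.unique hleast' ▸ hiq)
    · rw [he] at hp2 htog hip
      obtain rfl : T' = T := hq1.symm.trans hp2
      rw [← htog] at hleast
      exact hi' (hleast.unique hleast' ▸ hip)
    · rw [he] at hp2 htog h
      obtain rfl : T' = T := hq2.symm.trans hp2
      rw [← htog, htog'] at hleast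
      obtain rfl := hleast.unique hleast'
      obtain ⟨u, hu, -, -⟩ := exists_parent hT.1 r hiT
      exact Prod.ext (Subtype.ext (h.unique_left h' hi hi' hu hone hone')) he

omit hG in
open Classical in
/-- A quantity that increases along every arrow of the modified graph: the tree of the interval
in lexicographic order, then the weight, then whether the least togglable edge is missing, then
the number of edges. -/
noncomputable def rank (O : Fin n ≃ G.edgeSet) (r : V) (c : EnhancedState O) :
    List (Fin n) ×ₗ ℕ ×ₗ ℕ ×ₗ ℕ :=
  let T := intervalTree O c.edges
  toLex (T.sort (· ≤ ·), toLex (xWeight O r T c,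
    toLex (if ∃ i ∈ c.edges, IsLeast (togglable O r T c) i then 0 else 1, c.edges.card)))

theorem rank_lt_of_reversedArrow {c d : (nbcComplex O).Ω}
    (h : (nbcComplex O).ReversedArrow (toggleMatching O r) c d) :
    rank O r c.1 < rank O r d.1 := by
  classical
  rcases h with ⟨harr, hM⟩ | hM
  · obtain ⟨i, hi, h⟩ := exists_isEdgeImage_of_arrow harr
    have hcd : c.1.edges ⊆ d.1.edges := by rw [h.1]; exact Finset.subset_insert _ _
    obtain ⟨hTc, hTc1, hTc2⟩ := intervalTree_spec hG c.2
    obtain ⟨hTd, hTd1, hTd2⟩ := intervalTree_spec hG d.2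
    -- The tree of the interval does not decrease, since it is the first tree containing the set.
    have hnlt := not_lexLT_of_inactive_subset hTc hTd hTc1 hcd hTd2
    rw [rank, rank, Prod.Lex.toLex_lt_toLex]
    by_cases hT : intervalTree O c.1.edges = intervalTree O d.1.edges
    · refine Or.inr ⟨by simp only [hT], ?_⟩
      -- As the arrow is not reversed, the added edge is not the least togglable one.
      have hM' : ∀ k, IsLeast (togglable O r (intervalTree O c.1.edges) c.1) k → k ≠ i := by
        rintro k hk rfl
        exact hM ⟨k, hk, hi, h⟩
      rw [hT] at hTc1 hM'
      simp only [hT]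
      generalize intervalTree O d.1.edges = T at *
      rw [Prod.Lex.toLex_lt_toLex]
      rcases hcol : c.1.colorAt (child O r T i) with _ | _
      · refine Or.inr ⟨(h.xWeight_eq hTd.1 hi hTd2 hcol).symm, ?_⟩
        rw [Prod.Lex.toLex_lt_toLex]
        refine Or.inr ⟨if_congr ?_ rfl rfl, ?_⟩
        · rw [h.togglable_eq hTd.1 hi hTd2 hcol, h.1]
          refine exists_congr fun k => and_congr_left fun hk => ?_
          simp [hM' k hk]
        · simp only [h.1, Finset.card_insert_of_notMem hi]
          omega
      · exact Or.inl (h.xWeight_lt hTd.1 hi hTd2 hcol)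
    · exact Or.inl ((LexLT.total hT).resolve_right hnlt)
  · obtain ⟨T, i, hT, -, hcT, -, hi, h, hone, hTd, hTc, htog, hleast⟩ := toggleMatching_spec hG hM
    simp only at hcT hi h hone hTd hTc htog hleast
    rw [rank, rank, hTc, hTd, Prod.Lex.toLex_lt_toLex]
    refine Or.inr ⟨rfl, ?_⟩
    rw [Prod.Lex.toLex_lt_toLex]
    refine Or.inr ⟨h.xWeight_eq hT.1 hi hcT hone, ?_⟩
    rw [Prod.Lex.toLex_lt_toLex]
    refine Or.inl ?_
    rw [if_pos ⟨i, by rw [h.1]; exact Finset.mem_insert_self _ _, htog ▸ hleast⟩, if_neg]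
    · exact zero_lt_one
    · rintro ⟨k, hk, hk'⟩
      exact hi (hleast.unique hk' ▸ hk)

theorem isAcyclicMatching_toggleMatching :
    (nbcComplex O).IsAcyclicMatching (toggleMatching O r) := by
  refine ⟨isMatching_toggleMatching hG, ?_, fun c hc => ?_⟩
  · rintro p ⟨i, -, hi, h⟩
    rw [incidence_of_isEdgeImage hi h]
    exact isUnit_edgeSign _ _
  · have key : ∀ d, Relation.TransGen ((nbcComplex O).ReversedArrow (toggleMatching O r)) c d →
        rank O r c.1 < rank O r d.1 := fun d hd => by
      induction hd with
      | single h => exact rank_lt_of_reversedArrow hG h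
      | tail _ h ih => exact ih.trans (rank_lt_of_reversedArrow hG h)
    exact lt_irrefl _ (key c hc)

theorem exists_interval_of_mem_toggleMatching {p : (nbcComplex O).Ω × (nbcComplex O).Ω}
    (hp : p ∈ toggleMatching O r) : ∃ T, IsNBCTree O T ∧
      nbcEdges p.1 ∈ Set.Icc (inactive O T) T ∧ nbcEdges p.2 ∈ Set.Icc (inactive O T) T := by
  obtain ⟨T, i, hT, h1, h2, -, -, h, -⟩ := toggleMatching_spec hG hp
  have h12 : p.1.1.edges ⊆ p.2.1.edges := by rw [h.1]; exact Finset.subset_insert _ _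
  exact ⟨T, hT, ⟨h1, h12.trans h2⟩, h1.trans h12, h2⟩

/-! ### The critical states -/

theorem mem_criticalStates_iff {c : (nbcComplex O).Ω} :
    c ∈ (nbcComplex O).criticalStates (toggleMatching O r) ↔
      togglable O r (intervalTree O c.1.edges) c.1 = ∅ := by
  constructor
  · intro hc
    by_contra hne
    obtain ⟨hT, hT1, hT2⟩ := intervalTree_spec hG c.2
    obtain ⟨i, hi1, hi2⟩ := Set.exists_min_image _ id
      (Set.toFinite (togglable O r (intervalTree O c.1.edges) c.1))
      (Set.nonempty_iff_ne_empty.2 hne)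
    have hi : IsLeast (togglable O r (intervalTree O c.1.edges) c.1) i := ⟨hi1, hi2⟩
    obtain ⟨u, hu, hu1, hv1⟩ := exists_parent hT.1 r hi.1.1
    by_cases hic : i ∈ c.1.edges
    · have hnr : ¬ (spanningSubgraph O (c.1.edges.erase i)).Reachable u
          (child O r (intervalTree O c.1.edges) i) := fun hr =>
        hu1 ((mem_branch_iff_of_reachable ((Finset.erase_subset _ _).trans hT2)
          (Finset.notMem_erase _ _) hr).2 hv1)
      obtain ⟨b, hb, hbc, hone⟩ := exists_isEdgeImage_erase hu hic hnr
      have hib : i ∉ b.edges := by rw [hb]; simp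
      have hbT : b.edges ⊆ intervalTree O c.1.edges := by
        rw [hb]; exact (Finset.erase_subset _ _).trans hT2
      have hTb : intervalTree O b.edges = intervalTree O c.1.edges := by
        refine hT.intervalTree_eq hG (fun j hj => ?_) hbT
        rw [hb]
        exact Finset.mem_erase.2 ⟨ne_of_mem_of_not_mem hj hi.1.2.1, hT1 hj⟩
      refine (hc (⟨b, nbc_mono hbT hT.2⟩, c) ⟨i, ?_, hib, hbc⟩).2 rfl
      show IsLeast (togglable O r (intervalTree O b.edges) b) i
      rwa [hTb, ← hbc.togglable_eq hT.1 hib hT2 hone]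
    · obtain ⟨d, hd⟩ := exists_isEdgeImage hu (hi.1.2.2.resolve_left hic)
      have hdT : d.edges ⊆ intervalTree O c.1.edges := by
        rw [hd.1]; exact Finset.insert_subset hi.1.1 hT2
      exact (hc (c, ⟨d, nbc_mono hdT hT.2⟩) ⟨i, hi, hic, hd⟩).1 rfl
  · intro hc p hp
    obtain ⟨T, i, -, -, -, -, -, -, -, hp1, hp2, htog, hleast⟩ := toggleMatching_spec hG hp
    constructor
    · rintro rfl
      rw [hp1] at hc
      exact (hc ▸ hleast.1 : i ∈ (∅ : Set (Fin n)))
    · rintro rfl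
      rw [hp2, htog] at hc
      exact (hc ▸ hleast.1 : i ∈ (∅ : Set (Fin n)))

omit hG [Finite V] in
open Classical in
theorem signedState_plus_colorAt (T : Finset (Fin n)) (w : V) :
    (signedState O r T .plus).colorAt w =
      if (spanningSubgraph O (inactive O T)).Reachable w r then .one else .x := by
  refine if_congr ?_ rfl rfl
  exact SimpleGraph.ConnectedComponent.eq

omit hG [Finite V] in
theorem signedState_minus_colorAt (T : Finset (Fin n)) (w : V) :
    (signedState O r T .minus).colorAt w = .x := rfl

omit hG [Finite V] in
theorem not_reachable_child_root_inactive (hT : IsNBCTree O T) (hi : i ∈ T)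
    (hin : i ∉ inactive O T) :
    ¬ (spanningSubgraph O (inactive O T)).Reachable (child O r T i) r :=
  not_reachable_child_root hT.1 (inactive_subset T) hi hin

theorem IsNBCTree.intervalTree_signedState (hT : IsNBCTree O T) (s : TreeSign) :
    intervalTree O (signedState O r T s).edges = T := by
  rw [signedState_edges]
  exact hT.intervalTree_eq hG subset_rfl (inactive_subset T)

theorem bijOn_signedTreeState : Set.BijOn (signedTreeState O r) Set.univ
    ((nbcComplex O).criticalStates (toggleMatching O r)) := by
  refine ⟨fun ⟨⟨T, hT⟩, s⟩ _ => ?_, ?_, fun c hc => ?_⟩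
  · rw [mem_criticalStates_iff hG]
    show togglable O r (intervalTree O (signedState O r T s).edges) (signedState O r T s) = ∅
    rw [hT.intervalTree_signedState hG]
    refine Set.eq_empty_iff_forall_notMem.2 fun i ⟨hi, hin, h⟩ => ?_
    rw [signedState_edges] at h
    have h := h.resolve_left hin
    cases s with
    | plus =>
      rw [signedState_plus_colorAt, if_neg (not_reachable_child_root_inactive hT hi hin)] at h
      simp at h
    | minus => simp [signedState_minus_colorAt] at h
  · rintro ⟨⟨T, hT⟩, s⟩ - ⟨⟨T', hT'⟩, s'⟩ - h
    have h' : signedState O r T s = signedState O r T' s' := congrArg Subtype.val h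
    obtain rfl : T = T' := by
      rw [← hT.intervalTree_signedState (r := r) hG s, h', hT'.intervalTree_signedState hG]
    have hr := congrArg (fun c => c.colorAt r) h'
    have hp : (signedState O r T .plus).colorAt r = .one := by
      rw [signedState_plus_colorAt, if_pos (.refl _)]
    have hm := signedState_minus_colorAt (O := O) (r := r) T r
    cases s <;> cases s' <;> simp_all
  · rw [mem_criticalStates_iff hG] at hc
    obtain ⟨hT, hT1, hT2⟩ := intervalTree_spec hG c.2
    generalize intervalTree O c.1.edges = T at *
    have hn : ∀ i ∈ T, i ∉ inactive O T →
        i ∉ c.1.edges ∧ c.1.colorAt (child O r T i) = .x := fun i hi hin => by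
      have h : i ∉ togglable O r T c.1 := by rw [hc]; simp
      refine ⟨fun h' => h ⟨hi, hin, Or.inl h'⟩, Color.ne_one_iff.1 fun h' =>
        h ⟨hi, hin, Or.inr h'⟩⟩
    have hE : inactive O T = c.1.edges := by
      refine hT1.antisymm fun i hi => ?_
      by_contra hin
      exact (hn i (hT2 hi) hin).1 hi
    have hx : ∀ w, ¬ c.1.graph.Reachable r w → c.1.colorAt w = .x := by
      intro w hw
      obtain ⟨i, hi, hic, h⟩ := (exists_top (r := r) hT.1 hT2 w).resolve_left hw
      rw [← c.1.colorAt_eq h]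
      exact (hn i hi (hE ▸ hic)).2
    rcases hcr : c.1.colorAt r with _ | _
    · refine ⟨(⟨T, hT⟩, .plus), trivial, Subtype.ext (EnhancedState.ext' hE fun w => ?_)⟩
      show (signedState O r T .plus).colorAt w = _
      rw [signedState_plus_colorAt, hE]
      split_ifs with hw
      · rw [c.1.colorAt_eq hw, hcr]
      · exact (hx w fun h => hw h.symm).symm
    · refine ⟨(⟨T, hT⟩, .minus), trivial, Subtype.ext (EnhancedState.ext' hE fun w => ?_)⟩
      show (signedState O r T .minus).colorAt w = _
      rw [signedState_minus_colorAt]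
      by_cases hw : c.1.graph.Reachable r w
      · rw [← c.1.colorAt_eq hw, hcr]
      · exact (hx w hw).symm

end

end Chromatic

theorem theorem3 {V : Type*} [Finite V] (G : SimpleGraph V) (hG : G.Connected)
    {n : ℕ} (O : Fin n ≃ G.edgeSet) (r : V) :
    ((∀ T, Shelling.IsFacet (Chromatic.NBC O) T ↔ Chromatic.IsNBCTree O T) ∧
      Shelling.IsShelling (Chromatic.NBC O) Chromatic.LexLT ∧
      (∀ T, Chromatic.IsNBCTree O T →
        Shelling.restriction (Chromatic.NBC O) Chromatic.LexLT T = Chromatic.inactive O T) ∧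
      ∀ S ∈ Chromatic.NBC O,
        ∃! T, Chromatic.IsNBCTree O T ∧ S ∈ Set.Icc (Chromatic.inactive O T) T) ∧
    ∃ M : Set ((Chromatic.nbcComplex O).Ω × (Chromatic.nbcComplex O).Ω),
      (Chromatic.nbcComplex O).IsAcyclicMatching M ∧
      (∀ p ∈ M, ∃ T, Chromatic.IsNBCTree O T ∧
        Chromatic.nbcEdges p.1 ∈ Set.Icc (Chromatic.inactive O T) T ∧
        Chromatic.nbcEdges p.2 ∈ Set.Icc (Chromatic.inactive O T) T) ∧
      Set.BijOn (Chromatic.signedTreeState O r) Set.univ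
        ((Chromatic.nbcComplex O).criticalStates M) := by
  exact ⟨⟨fun T => Chromatic.isFacet_nbc_iff hG, Chromatic.isShelling_nbc hG,
    fun T hT => hT.restriction_eq hG, fun S hS => Chromatic.existsUnique_interval hG hS⟩,
    Chromatic.toggleMatching O r, Chromatic.isAcyclicMatching_toggleMatching hG,
    fun p hp => Chromatic.exists_interval_of_mem_toggleMatching hG hp,
    Chromatic.bijOn_signedTreeState hG⟩
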